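/- **Setting.** Let $d\ge 1$, $N\ge 0$. Let $\mathcal X\subset\mathbb R^d$ be closed and convex with $r\mathbb B\subseteq\mathcal X\subseteq R\,\mathbb B$, $0<r\le R$, where $\mathbb B$ is the closed unit ball. For every slot $t=1,2,\dots$ let $f_t:\mathbb R^d\to\mathbb R$ and $g_t=(g_t^1,\dots,g_t^N):\mathbb R^d\to\mathbb R^N$ be (entrywise) convex and differentiable at the points of $\mathcal X$, with $|f_t|\le F$, $\|\nabla f_t\|\le G$ and $\|\nabla g^n_t\|\le G$ on $\mathcal X$. Assume that there are $\eta>0$, $\gamma_0\in(0,1)$ and $\tilde x\in(1-\gamma_0)\mathcal X$ with $g^n_t(\tilde x)\le-\eta$ for all $t,n$. Let $x_t^*$ be a minimizer of $f_t$ over $\{x\in\mathcal X: g_t(x)\le 0\}$, and $V(x^*_{1:T})=\sum_{t=2}^T\|x_t^*-x_{t-1}^*\|$. **Algorithm (BanSaP).** For a horizon $T$ take parameters $\alpha=\mu>0$, $\delta>0$, $\gamma=\delta/r<1$, an initial point $\hat x_1\in(1-\gamma)\mathcal X$, $\lambda_1=0\in\mathbb R^N$, and independent $u_1,u_2,\dots$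 uniformly distributed on the unit sphere of $\mathbb R^d$. With projection $P_{(1-\gamma)\mathcal X}$ and positive part $[\cdot]^+$ taken entrywise, $$\hat x_{t+1}=P_{(1-\gamma)\mathcal X}\Big(\hat x_t-\alpha\big(\hat\nabla f_t(\hat x_t)+\textstyle\sum_n\lambda_t^n\nabla g_t^n(\hat x_t)\big)\Big),\qquad \lambda^n_{t+1}=\big[\lambda^n_t+\mu\big(g^n_t(\hat x_t)+\langle\nabla g^n_t(\hat x_t),\hat x_{t+1}-\hat x_t\rangle\big)\big]^+ .$$ With one-point feedback ($M=1$) the action is $x_{1,t}=\hat x_t+\delta u_t$ and $\hat\nabla f_t(\hat x_t)=\frac d\delta f_t(\hat x_t+\delta u_t)u_t$. With two-point feedback ($M=2$) the actions are $x_{1,t}=\hat x_t+\delta u_t$, $x_{2,t}=\hat x_t-\delta u_t$ and $\hat\nabla f_t(\hat x_t)=\frac d{2\delta}\big(f_t(\hat x_t+\delta u_t)-f_t(\hat x_t-\delta u_t)\big)u_t$. Put $$\mathrm{Reg}^d_T=\frac1M\sum_{t=1}^T\sum_{m=1}^M\mathbb E[f_t(x_{m,t})]-\sum_{t=1}^Tf_t(x_t^*),\qquad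 \mathrm{Fit}^d_T=\Big\|\Big[\frac1M\sum_{t=1}^T\sum_{m=1}^Mg_t(x_{m,t})\Big]^+\Big\| .$$ **Claim.** Let $\rho\in[0,1)$ and suppose $V(x^*_{1:T})=o(T^\rho)$ as $T\to\infty$. (1) One-point feedback: let $a_1T^{\frac34(\rho-1)}\le\alpha=\mu\le a_2T^{\frac34(\rho-1)}$ and $b_1T^{\frac14(\rho-1)}\le\delta\le b_2T^{\frac14(\rho-1)}$ for all large $T$, with $a_1,b_1>0$. Then there is a non-random $C$ such that $\mathrm{Reg}^d_T\le C\,T^{\frac14(\rho+3)}$ for all large $T$; almost surely $\mathrm{Fit}^d_T\le C\,T^{\frac14(\rho+3)}$ for all large $T$; and $\mathbb E[\mathrm{Fit}^d_T]\le C\,T^{\frac14(\rho+3)}$ for all large $T$. (2) Two-point feedback: let $a_1T^{\frac12(\rho-1)}\le\alpha=\mu\le a_2T^{\frac12(\rho-1)}$ and $0<\delta\le b_2T^{\frac12(\rho-1)}$ for all large $T$, with $a_1>0$. Then there is a non-random $C$ such that, for all large $T$, $\mathrm{Reg}^d_T\le C\,T^{\frac12(\rho+1)}$ and, almost surely, $\mathrm{Fit}^d_T\le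 C\,T^{\frac12(\rho+1)}$. The expectations exist (the losses $f_t(x_{m,t})$, $t\le T$, in both cases and $\mathrm{Fit}^d_T$ in (1) are integrable for all large $T$). In both cases $C$ depends only on $d,N,F,G,\eta,r,R,\rho$ and the constants $a_1,a_2,b_1,b_2$. The runs for different $T$ may be dependent in any way. -/

import Mathlib

open Filter Topology MeasureTheory ProbabilityTheory Asymptotics
open scoped Pointwise Gradient

/-- Euclidean space `ℝⁿ` with its Euclidean norm. -/
abbrev Vec (n : ℕ) : Type := EuclideanSpace ℝ (Fin n)

/-- The unit sphere of `ℝᵈ`. -/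
abbrev UnitSphere (d : ℕ) : Type := Metric.sphere (0 : Vec d) 1

/-- The uniform distribution on the unit sphere: normalized surface measure
(for `d = 1` the two points `1` and `-1` get mass `1/2` each). -/
noncomputable def uniformSphere (d : ℕ) : Measure (UnitSphere d) :=
  ((volume : Measure (Vec d)).toSphere Set.univ)⁻¹ • (volume : Measure (Vec d)).toSphere

/-- `p` minimizes `‖p - y‖` over `p ∈ K`. -/
def IsProjection {d : ℕ} (K : Set (Vec d)) (y p : Vec d) : Prop :=
  p ∈ K ∧ ∀ x ∈ K, ‖p - y‖ ≤ ‖x - y‖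

/-- The Euclidean projection `P_K(y)` (meaningful for `K` nonempty, closed and convex). -/
noncomputable def proj {d : ℕ} (K : Set (Vec d)) (y : Vec d) : Vec d :=
  Classical.epsilon (IsProjection K y)

theorem proj_spec {d : ℕ} {K : Set (Vec d)} (hne : K.Nonempty) (hcl : IsClosed K) (y : Vec d) :
    IsProjection K y (proj K y) := by
  obtain ⟨p, hp, h⟩ := hcl.exists_infDist_eq_dist hne y
  refine Classical.epsilon_spec (p := IsProjection K y) ⟨p, hp, fun x hx => ?_⟩
  have := Metric.infDist_le_dist_of_mem (x := y) hx
  rw [h, dist_comm y p, dist_comm y x, dist_eq_norm, dist_eq_norm] at this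
  exact this

/-- The data of the problem: the action set `X`, the losses `f t` and the constraint functions
`g t` with entries `g t x n`. Slots are numbered from `0`, so that a horizon `T`
consists of the slots `0, …, T - 1`. -/
structure OnlineProblem (d N : ℕ) where
  X : Set (Vec d)
  f : ℕ → Vec d → ℝ
  g : ℕ → Vec d → Vec N

namespace OnlineProblem

variable {d N : ℕ}

/-- The standing assumptions, with constants `F, G, η, r, R`. -/
structure Regular (Q : OnlineProblem d N) (F G η r R : ℝ) : Prop where
  convex_X : Convex ℝ Q.X
  closed_X : IsClosed Q.X
  convex_f : ∀ t, ConvexOn ℝ Set.univ (Q.f t)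
  convex_g : ∀ t n, ConvexOn ℝ Set.univ (fun x => Q.g t x n)
  bound_f : ∀ t, ∀ x ∈ Q.X, |Q.f t x| ≤ F
  diff_f : ∀ t, ∀ x ∈ Q.X, DifferentiableAt ℝ (Q.f t) x
  grad_f : ∀ t, ∀ x ∈ Q.X, ‖∇ (Q.f t) x‖ ≤ G
  diff_g : ∀ t n, ∀ x ∈ Q.X, DifferentiableAt ℝ (fun y => Q.g t y n) x
  grad_g : ∀ t n, ∀ x ∈ Q.X, ‖∇ (fun y => Q.g t y n) x‖ ≤ G
  eta_pos : 0 < η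
  slater : ∃ γ₀ ∈ Set.Ioo (0 : ℝ) 1, ∃ z ∈ (1 - γ₀) • Q.X, ∀ t n, Q.g t z n ≤ -η
  r_pos : 0 < r
  r_le_R : r ≤ R
  ball_subset : Metric.closedBall 0 r ⊆ Q.X
  subset_ball : Q.X ⊆ Metric.closedBall 0 R

/-- `xs t` solves `min f t x` over `x ∈ X` subject to `g t x ≤ 0`, in every slot `t`. -/
def IsSlotMinimizer (Q : OnlineProblem d N) (xs : ℕ → Vec d) : Prop :=
  ∀ t, (xs t ∈ Q.X ∧ ∀ n, Q.g t (xs t) n ≤ 0) ∧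
    ∀ x ∈ Q.X, (∀ n, Q.g t x n ≤ 0) → Q.f t (xs t) ≤ Q.f t x

end OnlineProblem

/-- The accumulated variation of the first `T` terms of `xs`. -/
noncomputable def variation {d : ℕ} (xs : ℕ → Vec d) (T : ℕ) : ℝ :=
  ∑ t ∈ Finset.range (T - 1), ‖xs (t + 1) - xs t‖

/-- One-point or two-point feedback. -/
inductive Feedback
  | one
  | two

namespace Feedback

/-- The number of points queried per slot. -/
def M : Feedback → ℕ
  | one => 1
  | two => 2

/-- The points that are played when the iterate is `x` and the random direction is `v`. -/
noncomputable def query {d : ℕ} :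
    (fb : Feedback) → (δ : ℝ) → (x : Vec d) → (v : UnitSphere d) → Fin fb.M → Vec d
  | one, δ, x, v => ![x + δ • (v : Vec d)]
  | two, δ, x, v => ![x + δ • (v : Vec d), x - δ • (v : Vec d)]

/-- The gradient estimate of the loss `f` at the iterate `x`, from function values at
the played points only. -/
noncomputable def gradEst {d : ℕ} :
    (fb : Feedback) → (f : Vec d → ℝ) → (δ : ℝ) → (x : Vec d) → (v : UnitSphere d) → Vec d
  | one, f, δ, x, v => ((d : ℝ) / δ * f (x + δ • (v : Vec d))) • (v : Vec d)
  | two, f, δ, x, v =>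
      ((d : ℝ) / (2 * δ) * (f (x + δ • (v : Vec d)) - f (x - δ • (v : Vec d)))) • (v : Vec d)

end Feedback

/-- Step sizes `α` (primal), `μ` (dual), perturbation `δ`, shrinkage `γ`. -/
structure BanSaPParams where
  α : ℝ
  μ : ℝ
  δ : ℝ
  γ : ℝ

namespace OnlineProblem

variable {d N : ℕ}

/-- The estimated gradient of the slot-`t` Lagrangian with respect to `x` at `(x, l)`. -/
noncomputable def lagrangianGradEst (Q : OnlineProblem d N) (fb : Feedback) (δ : ℝ) (t : ℕ)
    (x : Vec d) (l : Vec N) (v : UnitSphere d) : Vec d :=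
  fb.gradEst (Q.f t) δ x v + ∑ n, l n • ∇ (fun y => Q.g t y n) x

/-- The primal update: a projected step onto `(1 - γ) X`. -/
noncomputable def primalStep (Q : OnlineProblem d N) (fb : Feedback) (p : BanSaPParams) (t : ℕ)
    (x : Vec d) (l : Vec N) (v : UnitSphere d) : Vec d :=
  proj ((1 - p.γ) • Q.X) (x - p.α • Q.lagrangianGradEst fb p.δ t x l v)

/-- The dual update, where `x` is the current and `x'` the next primal iterate. -/
noncomputable def dualStep (Q : OnlineProblem d N) (p : BanSaPParams) (t : ℕ)
    (x x' : Vec d) (l : Vec N) : Vec N :=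
  WithLp.toLp 2 fun n =>
    max (l n + p.μ * (Q.g t x n + inner ℝ (∇ (fun y => Q.g t y n) x) (x' - x))) 0

/-- The pair (primal iterate, dual iterate) at the beginning of slot `t`, along the
directions `v 0, v 1, …`, started at `(x₁, 0)`. -/
noncomputable def iterate (Q : OnlineProblem d N) (fb : Feedback) (p : BanSaPParams)
    (x₁ : Vec d) (v : ℕ → UnitSphere d) : ℕ → Vec d × Vec N
  | 0 => (x₁, 0)
  | t + 1 =>
    let s := Q.iterate fb p x₁ v t
    let x' := Q.primalStep fb p t s.1 s.2 (v t)
    (x', Q.dualStep p t s.1 x' s.2)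

/-- The `m`-th action played in slot `t`. -/
noncomputable def action (Q : OnlineProblem d N) (fb : Feedback) (p : BanSaPParams)
    (x₁ : Vec d) (v : ℕ → UnitSphere d) (t : ℕ) (m : Fin fb.M) : Vec d :=
  fb.query p.δ (Q.iterate fb p x₁ v t).1 (v t) m

/-- The dynamic regret over the horizon `T` against the sequence `xs`; the expectation is over
the random directions `u t : Ω → UnitSphere d`. -/
noncomputable def regret (Q : OnlineProblem d N) (fb : Feedback) (p : BanSaPParams)
    (x₁ : Vec d) {Ω : Type*} [MeasurableSpace Ω] (P : Measure Ω) (u : ℕ → Ω → UnitSphere d)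
    (xs : ℕ → Vec d) (T : ℕ) : ℝ :=
  1 / (fb.M : ℝ) * ∑ t ∈ Finset.range T, ∑ m,
      ∫ ω, Q.f t (Q.action fb p x₁ (fun s => u s ω) t m) ∂P
    - ∑ t ∈ Finset.range T, Q.f t (xs t)

/-- The dynamic fit over the horizon `T` along the directions `v`. -/
noncomputable def fit (Q : OnlineProblem d N) (fb : Feedback) (p : BanSaPParams)
    (x₁ : Vec d) (v : ℕ → UnitSphere d) (T : ℕ) : ℝ :=
  ‖(WithLp.toLp 2 fun n =>
      max (1 / (fb.M : ℝ) * ∑ t ∈ Finset.range T, ∑ m, Q.g t (Q.action fb p x₁ v t m) n) 0 :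
    Vec N)‖

end OnlineProblem

/-- `u 0, u 1, …` are independent and uniformly distributed on the unit sphere. -/
def IsUniformIID {d : ℕ} {Ω : Type*} [MeasurableSpace Ω] (P : Measure Ω)
    (u : ℕ → Ω → UnitSphere d) : Prop :=
  iIndepFun u P ∧ ∀ t, HasLaw (u t) (uniformSphere d) P

/-- The parameters with equal primal and dual step sizes `a`, perturbation `δ`
and shrinkage `δ / r`. -/
noncomputable def coupledParams (r a δ : ℝ) : BanSaPParams :=
  { α := a, μ := a, δ := δ, γ := δ / r }

/-! ### The uniform distribution on the sphere -/

/-! The engine is a primal-dual drift inequality (`potential_update_le`) for half the squared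
distance of the state to `(z, 0)`. Both variables use the same step size `a`, and the dual step
evaluates the linearized constraint at the new primal point. Hence the terms pairing the multipliers
with the constraint gradients cancel, and the second-order error does not involve the dual iterate.
What remains is `a` times the estimated loss gradient against `z - x`, `a` times the multipliers
against the constraints at `z`, and `a ^ 2 * stepConst`. The constraints are first truncated from
below, which makes them bounded and is harmless because the dual step takes a positive part.

The spherical estimator is an approximate subgradient in the mean (`integral_sphere_inner_le`). This
follows by pairing each direction with its mirror image in the hyperplane orthogonal to the
displacement and using convexity along that displacement; no smoothed loss and no divergence theorem
are needed.

Taking the shrunken minimizers as comparators and telescoping gives the regret; moving the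
comparator costs the variation divided by `a`, and the shrinkage costs `δ` times the accumulated
multipliers. Taking a Slater point as comparator instead produces a negative drift proportional to
the sum of the multipliers, so their expectations are bounded on average over the horizon.

The fit needs multipliers bounded over the whole horizon, since the dual update bounds each
constraint value by a dual increment over `a` plus small terms (`fit_le`). With two-point feedback
the gradient estimates are uniformly bounded and the Slater drift gives a deterministic bound. With
one-point feedback they have size `1 / δ`, and only their mean is bounded; an exponential moment of
the potential, a union bound over the slots and Borel–Cantelli over the horizons replace the
deterministic argument. The parameter ranges then balance all error terms. -/

theorem isProbabilityMeasure_uniformSphere {d : ℕ} (hd : 0 < d) :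
    IsProbabilityMeasure (uniformSphere d) := by
  constructor
  have : Nontrivial (Vec d) := by
    have : Nonempty (Fin d) := ⟨⟨0, hd⟩⟩
    infer_instance
  have h0 : (volume : Measure (Vec d)).toSphere Set.univ ≠ 0 := by
    rw [Ne, Measure.measure_univ_eq_zero]
    exact Measure.toSphere_ne_zero _
  rw [uniformSphere, Measure.smul_apply, smul_eq_mul]
  exact ENNReal.inv_mul_cancel h0 (measure_ne_top _ _)

theorem nonempty_unitSphere {d : ℕ} (hd : 0 < d) : Nonempty (UnitSphere d) := by
  have := isProbabilityMeasure_uniformSphere hd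
  exact nonempty_of_isProbabilityMeasure (uniformSphere d)

theorem norm_unitSphere {d : ℕ} (v : UnitSphere d) : ‖(v : Vec d)‖ = 1 := by simp

/-- The action of a linear isometry on the unit sphere. -/
noncomputable def sphereMap {d : ℕ} (A : Vec d ≃ₗᵢ[ℝ] Vec d) (v : UnitSphere d) : UnitSphere d :=
  ⟨A v, by simp⟩

theorem continuous_sphereMap {d : ℕ} (A : Vec d ≃ₗᵢ[ℝ] Vec d) : Continuous (sphereMap A) :=
  (A.continuous.comp continuous_subtype_val).subtype_mk _

/-- The surface measure of a set is a multiple of the volume of the cone over it; a linear isometry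
preserves volume and carries cones to cones. -/
theorem measurePreserving_sphereMap {d : ℕ} (A : Vec d ≃ₗᵢ[ℝ] Vec d) :
    MeasurePreserving (sphereMap A) (uniformSphere d) (uniformSphere d) := by
  refine ⟨(continuous_sphereMap A).measurable, ?_⟩
  ext s hs
  rw [Measure.map_apply (continuous_sphereMap A).measurable hs]
  simp only [uniformSphere, Measure.smul_apply]
  congr 1
  rw [Measure.toSphere_apply' _ ((continuous_sphereMap A).measurable hs),
    Measure.toSphere_apply' _ hs]
  congr 1
  have : Set.Ioo (0 : ℝ) 1 • ((↑) '' (sphereMap A ⁻¹' s) : Set (Vec d)) =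
      A ⁻¹' (Set.Ioo (0 : ℝ) 1 • ((↑) '' s : Set (Vec d))) := by
    ext x
    simp only [Set.mem_smul, Set.mem_image, Set.mem_preimage]
    constructor
    · rintro ⟨c, hc, _, ⟨v, hv, rfl⟩, rfl⟩
      exact ⟨c, hc, _, ⟨_, hv, rfl⟩, by simp [sphereMap]⟩
    · rintro ⟨c, hc, _, ⟨v, hv, rfl⟩, h⟩
      refine ⟨c, hc, _, ⟨sphereMap A.symm v, ?_, rfl⟩, ?_⟩
      · convert hv
        ext1
        simp [sphereMap]
      · apply A.injective
        simp [sphereMap, h]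
  rw [this]
  exact A.measurePreserving.measure_preimage_equiv (f := A.toMeasurableEquiv) _

theorem integral_sphereMap {d : ℕ} (A : Vec d ≃ₗᵢ[ℝ] Vec d) {φ : UnitSphere d → ℝ}
    (hφ : Continuous φ) :
    ∫ v, φ (sphereMap A v) ∂uniformSphere d = ∫ v, φ v ∂uniformSphere d := by
  rw [← (measurePreserving_sphereMap A).map_eq, integral_map
    (continuous_sphereMap A).aemeasurable hφ.aestronglyMeasurable,
    (measurePreserving_sphereMap A).map_eq]

theorem integrable_sphere {d : ℕ} (hd : 0 < d) {φ : UnitSphere d → ℝ} (hφ : Continuous φ) :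
    Integrable φ (uniformSphere d) := by
  have := isProbabilityMeasure_uniformSphere hd
  exact hφ.integrable_of_hasCompactSupport (HasCompactSupport.of_compactSpace φ)

/-- By symmetry the second moment is the same in every direction, and over an orthonormal basis the
squares add up to `1`. -/
theorem integral_inner_sq {d : ℕ} (hd : 0 < d) {e : Vec d} (he : ‖e‖ = 1) :
    ∫ v : UnitSphere d, (inner ℝ (v : Vec d) e) ^ 2 ∂uniformSphere d = 1 / d := by
  have := isProbabilityMeasure_uniformSphere hd
  have hcont (e : Vec d) : Continuous fun v : UnitSphere d => (inner ℝ (v : Vec d) e) ^ 2 := by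
    fun_prop
  have key (i : Fin d) : ∫ v : UnitSphere d, (inner ℝ (v : Vec d)
      (EuclideanSpace.basisFun (Fin d) ℝ i)) ^ 2 ∂uniformSphere d =
      ∫ v : UnitSphere d, (inner ℝ (v : Vec d) e) ^ 2 ∂uniformSphere d := by
    set b := EuclideanSpace.basisFun (Fin d) ℝ i with hb
    have hbe : ‖b‖ = ‖e‖ := by rw [he, hb]; simp
    -- The reflection in the hyperplane bisecting `b` and `e` takes `b` to `e`.
    have h := Submodule.reflection_sub hbe
    rw [← integral_sphereMap ((Submodule.span ℝ {b - e})ᗮ.reflection) (hcont e)]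
    congr 1; ext v
    simp only [sphereMap]
    have h' := LinearIsometryEquiv.inner_map_map
      ((Submodule.span ℝ {b - e})ᗮ.reflection) (v : Vec d) b
    rw [h] at h'
    rw [h']
  have hsum : ∑ i : Fin d, ∫ v : UnitSphere d, (inner ℝ (v : Vec d)
      (EuclideanSpace.basisFun (Fin d) ℝ i)) ^ 2 ∂uniformSphere d = 1 := by
    rw [← integral_finsetSum _ (fun i _ => integrable_sphere hd (hcont _))]
    have (v : UnitSphere d) : ∑ i : Fin d, (inner ℝ (v : Vec d)
        (EuclideanSpace.basisFun (Fin d) ℝ i)) ^ 2 = 1 := by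
      have := (EuclideanSpace.basisFun (Fin d) ℝ).sum_sq_inner_left (v : Vec d)
      simpa using this
    simp only [this]
    simp
  simp only [key, Finset.sum_const, Finset.card_univ, Fintype.card_fin, nsmul_eq_mul] at hsum
  have : (d : ℝ) ≠ 0 := by positivity
  field_simp
  linarith

/-! ### Convex functions -/

theorem continuous_of_convexOn_univ {d : ℕ} {f : Vec d → ℝ} (hf : ConvexOn ℝ Set.univ f) :
    Continuous f :=
  continuousOn_univ.1 (hf.continuousOn isOpen_univ)

/-- Only `x` has to be a point of differentiability. Convexity on the whole space lets `y` lie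
outside the action set. -/
theorem inner_gradient_le {d : ℕ} {f : Vec d → ℝ} (hf : ConvexOn ℝ Set.univ f) {x : Vec d}
    (hx : DifferentiableAt ℝ f x) (y : Vec d) : inner ℝ (∇ f x) (y - x) ≤ f y - f x := by
  have h1 : HasDerivAt (fun s : ℝ => f (x + s • (y - x))) (inner ℝ (∇ f x) (y - x)) 0 := by
    have h2 : HasFDerivAt f (fderiv ℝ f x) (x + (0 : ℝ) • (y - x)) := by
      simpa using hx.hasFDerivAt
    have h3 : HasDerivAt (fun s : ℝ => x + s • (y - x)) (y - x) 0 := by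
      simpa using ((hasDerivAt_id (0 : ℝ)).smul_const (y - x)).const_add x
    have := h2.comp_hasDerivAt (0 : ℝ) h3
    have h4 : inner ℝ (∇ f x) (y - x) = fderiv ℝ f x (y - x) := by
      rw [gradient, InnerProductSpace.toDual_symm_apply]
    rw [h4]; exact this
  have hc : ConvexOn ℝ Set.univ (fun s : ℝ => f (x + s • (y - x))) := by
    refine ⟨convex_univ, fun a _ b _ p q hp hq hpq => ?_⟩
    have := hf.2 (Set.mem_univ (x + a • (y - x))) (Set.mem_univ (x + b • (y - x))) hp hq hpq
    refine le_trans (le_of_eq ?_) this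
    obtain rfl : q = 1 - p := by linarith
    change f (x + (p • a + (1 - p) • b) • (y - x)) = f _
    simp only [smul_eq_mul]
    congr 1
    module
  have := hc.le_slope_of_hasDerivAt (Set.mem_univ 0) (Set.mem_univ 1) one_pos h1
  simpa [slope_def_field] using this

/-- The increment of a convex function along a chord, compared with a shorter step backwards. -/
theorem backward_increment_le {d : ℕ} {f : Vec d → ℝ} (hf : ConvexOn ℝ Set.univ f)
    (p w : Vec d) {c : ℝ} (hc : 0 ≤ c) :
    f p - f (p - c • w) ≤ c * (f (p + w) - f p) := by
  have h1 : 0 < 1 + c := by linarith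
  -- The point `p` is the mean of `p - c • w` and `p + w` with weights `1 / (1 + c)` and `c / (1 +
  -- c)`.
  have := hf.2 (Set.mem_univ (p - c • w)) (Set.mem_univ (p + w))
    (show 0 ≤ 1 / (1 + c) by positivity) (show 0 ≤ c / (1 + c) by positivity) (by field_simp)
  have h2 : (1 / (1 + c)) • (p - c • w) + (c / (1 + c)) • (p + w) = p := by
    have : (1 / (1 + c)) • (p - c • w) + (c / (1 + c)) • (p + w) =
      ((1 / (1 + c)) + (c / (1 + c))) • p + (c / (1 + c) - 1 / (1 + c) * c) • w := by module
    rw [this]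
    have h3 : (1 / (1 + c)) + (c / (1 + c)) = 1 := by field_simp
    have h4 : c / (1 + c) - 1 / (1 + c) * c = 0 := by ring
    rw [h3, h4]; simp
  rw [h2] at this
  simp only [smul_eq_mul] at this
  have h5 : (1 + c) * f p ≤ f (p - c • w) + c * f (p + w) := by
    calc (1 + c) * f p ≤ (1 + c) * (1 / (1 + c) * f (p - c • w) + c / (1 + c) * f (p + w)) := by
          gcongr
      _ = _ := by field_simp
  linarith

/-- The spherical gradient estimator of a convex function is an approximate subgradient. -/
theorem integral_sphere_inner_le {d : ℕ} (hd : 0 < d) {f : Vec d → ℝ}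
    (hf : ConvexOn ℝ Set.univ f) {x w : Vec d} {δ D : ℝ} (hδ : 0 < δ) (hD0 : w = 0 → 0 ≤ D)
    (hD : ∀ v : UnitSphere d, f (x + δ • (v : Vec d) + w) - f (x + δ • (v : Vec d)) ≤ D) :
    ∫ v : UnitSphere d, (d : ℝ) / δ * f (x + δ • (v : Vec d)) * inner ℝ (v : Vec d) w
      ∂uniformSphere d ≤ D := by
  have := isProbabilityMeasure_uniformSphere hd
  have hfc := continuous_of_convexOn_univ hf
  have hd' : (0 : ℝ) < d := by exact_mod_cast hd
  rcases eq_or_ne w 0 with rfl | hw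
  · simpa using hD0 rfl
  have hw' : 0 < ‖w‖ := norm_pos_iff.2 hw
  set e : Vec d := ‖w‖⁻¹ • w with he
  have hne : ‖e‖ = 1 := by rw [he, norm_smul]; simp [hw'.ne']
  have hwe : w = ‖w‖ • e := by rw [he, smul_smul]; simp [hw'.ne']
  -- The reflection flips the sign of the component along `w` and moves the evaluation point
  -- parallel to `w`. So the sum over a mirror pair is an increment of `f` along `w`, which
  -- `backward_increment_le` compares with the forward increment bounded by `D`.
  set A : Vec d ≃ₗᵢ[ℝ] Vec d := (Submodule.span ℝ {e})ᗮ.reflection with hA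
  have hAv (v : Vec d) : A v = v - (2 * inner ℝ v e) • e := by
    rw [hA, Submodule.reflection_orthogonal_apply, Submodule.reflection_singleton_apply, hne,
      real_inner_comm]
    simp only [two_smul]
    module
  set φ : UnitSphere d → ℝ := fun v => f (x + δ • (v : Vec d)) * inner ℝ (v : Vec d) e with hφ
  have hφc : Continuous φ := by fun_prop
  have hpt (v : UnitSphere d) : φ v + φ (sphereMap A v) ≤
      2 * δ / ‖w‖ * D * (inner ℝ (v : Vec d) e) ^ 2 := by
    -- the case of a nonnegative inner product; the other case follows by reflection
    have main (v : UnitSphere d) (hs : 0 ≤ inner ℝ (v : Vec d) e) :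
        (f (x + δ • (v : Vec d)) - f (x + δ • A v)) * inner ℝ (v : Vec d) e ≤
        2 * δ / ‖w‖ * D * (inner ℝ (v : Vec d) e) ^ 2 := by
      set s := inner ℝ (v : Vec d) e
      have h1 := backward_increment_le hf (x + δ • (v : Vec d)) w (c := 2 * δ * s / ‖w‖)
        (by positivity)
      have h2 : x + δ • (v : Vec d) - (2 * δ * s / ‖w‖) • w = x + δ • A v := by
        rw [hAv, he]
        module
      rw [h2] at h1
      have h3 : 2 * δ * s / ‖w‖ * (f (x + δ • (v : Vec d) + w) - f (x + δ • (v : Vec d))) ≤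
          2 * δ * s / ‖w‖ * D := by
        gcongr; exact hD v
      calc _ ≤ (2 * δ * s / ‖w‖ * D) * s := by gcongr; linarith
        _ = _ := by ring
    have hAe : A e = -e := by
      rw [hAv, real_inner_self_eq_norm_sq, hne]
      module
    have hAs : inner ℝ (A v) e = - inner ℝ (v : Vec d) e := by
      have h := A.inner_map_map (v : Vec d) e
      rw [hAe, inner_neg_right] at h
      linarith
    have hAA : A (A v) = v := Submodule.reflection_reflection _ _
    simp only [hφ, sphereMap, hAs]
    rcases le_total 0 (inner ℝ (v : Vec d) e) with hs | hs
    · have := main v hs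
      linarith
    · have := main (sphereMap A v) (by simp only [sphereMap, hAs]; linarith)
      simp only [sphereMap, hAA, hAs] at this
      linarith
  -- The second moment `1 / d` cancels the factor `d` of the estimator. The sign of `D` plays no
  -- role in the pointwise bound.
  have hint : 2 * ∫ v, φ v ∂uniformSphere d ≤ 2 * δ / ‖w‖ * D * (1 / d) := by
    have h1 : 2 * ∫ v, φ v ∂uniformSphere d =
        ∫ v, (φ v + φ (sphereMap A v)) ∂uniformSphere d := by
      have h3 : Integrable (fun v => φ (sphereMap A v)) (uniformSphere d) :=
        integrable_sphere hd (hφc.comp (continuous_sphereMap A))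
      rw [integral_add (integrable_sphere hd hφc) h3, integral_sphereMap A hφc]
      ring
    rw [h1, ← integral_inner_sq hd hne, ← integral_const_mul]
    refine integral_mono (integrable_sphere hd (hφc.add (hφc.comp (continuous_sphereMap A))))
      (integrable_sphere hd (by fun_prop)) hpt
  have h2 : ∫ v : UnitSphere d, (d : ℝ) / δ * f (x + δ • (v : Vec d)) * inner ℝ (v : Vec d) w
      ∂uniformSphere d = (d / δ * ‖w‖) * ∫ v, φ v ∂uniformSphere d := by
    rw [← integral_const_mul]
    congr 1; ext v
    have : inner ℝ (v : Vec d) w = ‖w‖ * inner ℝ (v : Vec d) e := by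
      conv_lhs => rw [hwe]
      rw [inner_smul_right]
    rw [this]; simp only [hφ]; ring
  rw [h2]
  calc (d / δ * ‖w‖) * ∫ v, φ v ∂uniformSphere d
      ≤ (d / δ * ‖w‖) * (δ / ‖w‖ * D * (1 / d)) := by
        gcongr
        have : 2 * δ / ‖w‖ * D * (1 / d) = 2 * (δ / ‖w‖ * D * (1 / d)) := by ring
        linarith
    _ = D := by field_simp

/-! ### Projections -/

theorem proj_mem {d : ℕ} {K : Set (Vec d)} (hne : K.Nonempty) (hcl : IsClosed K) (y : Vec d) :
    proj K y ∈ K := (proj_spec hne hcl y).1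

theorem inner_proj_le_zero {d : ℕ} {K : Set (Vec d)} (hne : K.Nonempty) (hcl : IsClosed K)
    (hc : Convex ℝ K) (y : Vec d) {z : Vec d} (hz : z ∈ K) :
    inner ℝ (y - proj K y) (z - proj K y) ≤ 0 := by
  obtain ⟨h1, h2⟩ := proj_spec hne hcl y
  refine (norm_eq_iInf_iff_real_inner_le_zero hc h1).1 ?_ z hz
  have : Nonempty K := hne.to_subtype
  refine le_antisymm (le_ciInf fun w => ?_) ?_
  · rw [norm_sub_rev, norm_sub_rev y]
    exact h2 w w.2
  · exact ciInf_le ⟨0, by rintro _ ⟨w, rfl⟩; exact norm_nonneg _⟩ (⟨proj K y, h1⟩ : K)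

/-- The projection is nonexpansive: add the variational inequalities at the two projected points.
This serves the measurability of the iterates. -/
theorem continuous_proj {d : ℕ} {K : Set (Vec d)} (hne : K.Nonempty) (hcl : IsClosed K)
    (hc : Convex ℝ K) : Continuous (proj K) := by
  refine (LipschitzWith.of_dist_le_mul (K := 1) fun x y => ?_).continuous
  rw [NNReal.coe_one, one_mul, dist_eq_norm, dist_eq_norm]
  have h1 := inner_proj_le_zero hne hcl hc x (proj_mem hne hcl y)
  have h2 := inner_proj_le_zero hne hcl hc y (proj_mem hne hcl x)
  set p := proj K x
  set q := proj K y
  have h3 : ‖p - q‖ ^ 2 ≤ inner ℝ (x - y) (p - q) := by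
    rw [← real_inner_self_eq_norm_sq]
    have e1 : inner ℝ (x - p) (q - p) = - inner ℝ (x - p) (p - q) := by
      rw [← inner_neg_right, neg_sub]
    have e2 : inner ℝ (p - q) (p - q) =
        inner ℝ (x - y) (p - q) - inner ℝ (x - p) (p - q) + inner ℝ (y - q) (p - q) := by
      rw [← inner_sub_left, ← inner_add_left]
      congr 1
      abel
    linarith
  have h4 := real_inner_le_norm (x - y) (p - q)
  by_contra! h
  nlinarith [norm_nonneg (x - y), norm_nonneg (p - q)]

/-- One projected step, compared with a point `z` of the feasible set. -/
theorem norm_sub_proj_sq_le {d : ℕ} {K : Set (Vec d)} (hne : K.Nonempty) (hcl : IsClosed K)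
    (hc : Convex ℝ K) (x w : Vec d) {z : Vec d} (hz : z ∈ K) :
    ‖z - proj K (x - w)‖ ^ 2 / 2 ≤ ‖z - x‖ ^ 2 / 2 - ‖proj K (x - w) - x‖ ^ 2 / 2
      + inner ℝ w (z - x) - inner ℝ w (proj K (x - w) - x) := by
  have h := inner_proj_le_zero hne hcl hc (x - w) hz
  set p := proj K (x - w)
  have e1 : ‖z - x‖ ^ 2 = ‖z - p‖ ^ 2 + 2 * inner ℝ (z - p) (p - x) + ‖p - x‖ ^ 2 := by
    rw [← norm_add_sq_real]; congr 2; abel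
  have e2 : inner ℝ (x - w - p) (z - p) = - inner ℝ (z - p) (p - x) - inner ℝ w (z - p) := by
    rw [real_inner_comm (p - x), ← inner_neg_left, ← inner_sub_left]
    congr 1; abel
  have e3 : inner ℝ w (z - p) = inner ℝ w (z - x) - inner ℝ w (p - x) := by
    rw [← inner_sub_right]; congr 1; abel
  linarith

/-! ### Consequences of the standing assumptions -/

namespace OnlineProblem

variable {d N : ℕ} {Q : OnlineProblem d N} {F G η r R : ℝ}

namespace Regular

theorem zero_mem (h : Q.Regular F G η r R) : (0 : Vec d) ∈ Q.X :=
  h.ball_subset (by simp [h.r_pos.le])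

theorem F_nonneg (h : Q.Regular F G η r R) : 0 ≤ F :=
  (abs_nonneg _).trans (h.bound_f 0 0 h.zero_mem)

theorem G_nonneg (h : Q.Regular F G η r R) : 0 ≤ G :=
  (norm_nonneg _).trans (h.grad_f 0 0 h.zero_mem)

theorem R_pos (h : Q.Regular F G η r R) : 0 < R := h.r_pos.trans_le h.r_le_R

theorem norm_le (h : Q.Regular F G η r R) {x : Vec d} (hx : x ∈ Q.X) : ‖x‖ ≤ R := by
  simpa using h.subset_ball hx

theorem norm_sub_le (h : Q.Regular F G η r R) {x y : Vec d} (hx : x ∈ Q.X) (hy : y ∈ Q.X) :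
    ‖x - y‖ ≤ 2 * R := by
  have := _root_.norm_sub_le x y
  linarith [h.norm_le hx, h.norm_le hy]

theorem smul_subset_smul (h : Q.Regular F G η r R) {a b : ℝ} (ha : 0 ≤ a) (hab : a ≤ b) :
    a • Q.X ⊆ b • Q.X := by
  rintro _ ⟨x, hx, rfl⟩
  rcases eq_or_lt_of_le (ha.trans hab) with hb | hb
  · obtain rfl : a = b := le_antisymm hab (hb ▸ ha)
    exact ⟨x, hx, rfl⟩
  · refine ⟨(a / b) • x, ?_, ?_⟩
    · exact h.convex_X.smul_mem_of_zero_mem h.zero_mem hx ⟨by positivity, (div_le_one hb).2 hab⟩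
    · simp only [smul_smul]
      congr 1
      field_simp

theorem smul_subset (h : Q.Regular F G η r R) {a : ℝ} (ha : 0 ≤ a) (ha' : a ≤ 1) :
    a • Q.X ⊆ Q.X := by
  simpa using h.smul_subset_smul ha ha'

/-- The perturbed point is the convex combination of a point of `X` and the point `r • v` with
weights `1 - δ / r` and `δ / r`. This is the reason for the shrinkage `γ = δ / r`. -/
theorem add_smul_mem (h : Q.Regular F G η r R) {δ : ℝ} (hδ : 0 ≤ δ) (hδr : δ / r ≤ 1)
    {x v : Vec d} (hx : x ∈ (1 - δ / r) • Q.X) (hv : ‖v‖ = 1) : x + δ • v ∈ Q.X := by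
  obtain ⟨y, hy, rfl⟩ := hx
  have hr := h.r_pos
  have hv' : r • v ∈ Q.X := by
    apply h.ball_subset
    simp [norm_smul, hv, abs_of_pos hr]
  have h1 : 0 ≤ δ / r := by positivity
  have := h.convex_X hy hv' (sub_nonneg.2 hδr) h1 (by ring)
  rwa [smul_smul, div_mul_cancel₀ _ hr.ne'] at this

theorem sub_smul_mem (h : Q.Regular F G η r R) {δ : ℝ} (hδ : 0 ≤ δ) (hδr : δ / r ≤ 1)
    {x v : Vec d} (hx : x ∈ (1 - δ / r) • Q.X) (hv : ‖v‖ = 1) : x - δ • v ∈ Q.X := by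
  have := h.add_smul_mem hδ hδr hx (v := -v) (by simpa using hv)
  simpa [sub_eq_add_neg] using this

theorem convex_smul (h : Q.Regular F G η r R) (a : ℝ) : Convex ℝ (a • Q.X) := h.convex_X.smul a

theorem closed_smul (h : Q.Regular F G η r R) (a : ℝ) : IsClosed (a • Q.X) := by
  have hc : IsCompact Q.X :=
    (isCompact_closedBall (0 : Vec d) R).of_isClosed_subset h.closed_X h.subset_ball
  exact (hc.smul a).isClosed

theorem nonempty_smul (h : Q.Regular F G η r R) (a : ℝ) : (a • Q.X).Nonempty :=
  ⟨_, Set.smul_mem_smul_set h.zero_mem⟩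

theorem f_sub_le (h : Q.Regular F G η r R) (t : ℕ) {x : Vec d} (hx : x ∈ Q.X) (y : Vec d) :
    Q.f t x - Q.f t y ≤ G * ‖x - y‖ := by
  have h1 := inner_gradient_le (h.convex_f t) (h.diff_f t x hx) y
  have h2 := abs_real_inner_le_norm (∇ (Q.f t) x) (y - x)
  have h3 := h.grad_f t x hx
  rw [norm_sub_rev y x] at h2
  have h4 : ‖∇ (Q.f t) x‖ * ‖x - y‖ ≤ G * ‖x - y‖ := by gcongr
  linarith [neg_abs_le (inner ℝ (∇ (Q.f t) x) (y - x))]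

theorem abs_inner_grad_g_le (h : Q.Regular F G η r R) (t : ℕ) (n : Fin N) {x : Vec d}
    (hx : x ∈ Q.X) (w : Vec d) : |inner ℝ (∇ (fun y => Q.g t y n) x) w| ≤ G * ‖w‖ := by
  refine (abs_real_inner_le_norm _ w).trans ?_
  gcongr
  exact h.grad_g t n x hx

theorem inner_grad_g_le (h : Q.Regular F G η r R) (t : ℕ) (n : Fin N) {x : Vec d}
    (hx : x ∈ Q.X) (y : Vec d) :
    inner ℝ (∇ (fun y => Q.g t y n) x) (y - x) ≤ Q.g t y n - Q.g t x n :=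
  inner_gradient_le (h.convex_g t n) (h.diff_g t n x hx) y

theorem g_sub_le (h : Q.Regular F G η r R) (t : ℕ) (n : Fin N) {x : Vec d} (hx : x ∈ Q.X)
    (y : Vec d) : Q.g t x n - Q.g t y n ≤ G * ‖x - y‖ := by
  have h1 := h.inner_grad_g_le t n hx y
  have h2 := h.abs_inner_grad_g_le t n hx (y - x)
  rw [norm_sub_rev y x] at h2
  linarith [neg_abs_le (inner ℝ (∇ (fun y => Q.g t y n) x) (y - x))]

/-- The value at a Slater point plus the largest possible change over the diameter. There is no
matching lower bound, since the Slater value may be arbitrarily negative; hence the truncation in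
`truncLin`. -/
theorem g_le (h : Q.Regular F G η r R) (t : ℕ) (n : Fin N) {x : Vec d} (hx : x ∈ Q.X) :
    Q.g t x n ≤ 2 * R * G - η := by
  obtain ⟨γ, hγ, z, hz, hzg⟩ := h.slater
  have hzX := h.smul_subset (by linarith [hγ.2]) (by linarith [hγ.1]) hz
  have h1 := h.g_sub_le t n hx z
  have h2 : G * ‖x - z‖ ≤ G * (2 * R) := by
    gcongr
    · exact h.G_nonneg
    · exact h.norm_sub_le hx hzX
  linarith [hzg t n]

end Regular

/-! ### The one-step primal-dual inequality -/

/-- The linearized constraints at `x`, evaluated at `z`, truncated from below at `x`. -/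
noncomputable def truncLin (Q : OnlineProblem d N) (k : ℝ) (t : ℕ) (x z : Vec d) (n : Fin N) : ℝ :=
  max (Q.g t x n) (-k) + inner ℝ (∇ (fun y => Q.g t y n) x) (z - x)

namespace Regular

theorem abs_truncLin_le (h : Q.Regular F G η r R) (t : ℕ) {x z : Vec d} (hx : x ∈ Q.X)
    (hz : z ∈ Q.X) (n : Fin N) : |Q.truncLin (2 * R * G + η) t x z n| ≤ 4 * R * G + η := by
  have h1 := h.abs_inner_grad_g_le t n hx (z - x)
  have h2 : G * ‖z - x‖ ≤ G * (2 * R) := by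
    gcongr
    · exact h.G_nonneg
    · exact h.norm_sub_le hz hx
  have h3 := h.g_le t n hx
  have h4 : 0 ≤ R * G := mul_nonneg h.R_pos.le h.G_nonneg
  have h5 := h.eta_pos
  have h6 : |max (Q.g t x n) (-(2 * R * G + η))| ≤ 2 * R * G + η :=
    abs_le.2 ⟨le_max_right _ _, max_le (by linarith) (by linarith)⟩
  unfold truncLin
  refine (abs_add_le _ _).trans ?_
  linarith

/-- The level `2 * R * G + η` is chosen so that, where the truncation acts, adding a linear term of
at most `2 * R * G` still leaves at most `-η`. Otherwise this is the subgradient inequality. -/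
theorem truncLin_le (h : Q.Regular F G η r R) (t : ℕ) {x z : Vec d} (hx : x ∈ Q.X)
    (hz : z ∈ Q.X) (n : Fin N) :
    Q.truncLin (2 * R * G + η) t x z n ≤ max (Q.g t z n) (-η) := by
  have h1 := h.inner_grad_g_le t n hx z
  have h2 := le_abs_self (inner ℝ (∇ (fun y => Q.g t y n) x) (z - x))
  have h3 := h.abs_inner_grad_g_le t n hx (z - x)
  have h4 : G * ‖z - x‖ ≤ G * (2 * R) := by
    gcongr
    · exact h.G_nonneg
    · exact h.norm_sub_le hz hx
  unfold truncLin
  rcases max_cases (Q.g t x n) (-(2 * R * G + η)) with ⟨e, _⟩ | ⟨e, _⟩ <;> rw [e]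
  · exact le_max_of_le_left (by linarith)
  · exact le_max_of_le_right (by linarith)

end Regular

/-- The update of the pair (primal iterate, dual iterate) in slot `t` in direction `v`. -/
noncomputable def update (Q : OnlineProblem d N) (fb : Feedback) (p : BanSaPParams) (t : ℕ)
    (s : Vec d × Vec N) (v : UnitSphere d) : Vec d × Vec N :=
  (Q.primalStep fb p t s.1 s.2 v, Q.dualStep p t s.1 (Q.primalStep fb p t s.1 s.2 v) s.2)

theorem iterate_succ (fb : Feedback) (p : BanSaPParams) (x₁ : Vec d)
    (v : ℕ → UnitSphere d) (t : ℕ) :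
    Q.iterate fb p x₁ v (t + 1) = Q.update fb p t (Q.iterate fb p x₁ v t) (v t) := rfl

/-- Feasible states: the primal iterate is in the shrunken set, the dual iterate is nonnegative. -/
def Feasible (Q : OnlineProblem d N) (γ : ℝ) (s : Vec d × Vec N) : Prop :=
  s.1 ∈ (1 - γ) • Q.X ∧ ∀ n, 0 ≤ s.2 n

/-- Half the squared distance of a state to `(z, 0)`. -/
noncomputable def potential (z : Vec d) (s : Vec d × Vec N) : ℝ :=
  (‖s.2‖ ^ 2 + ‖z - s.1‖ ^ 2) / 2

theorem potential_nonneg (z : Vec d) (s : Vec d × Vec N) : 0 ≤ potential z s := by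
  unfold potential; positivity

namespace Regular

theorem feasible_update (h : Q.Regular F G η r R) (fb : Feedback) (p : BanSaPParams) (t : ℕ)
    (s : Vec d × Vec N) (v : UnitSphere d) : Q.Feasible p.γ (Q.update fb p t s v) :=
  ⟨proj_mem (h.nonempty_smul _) (h.closed_smul _) _, fun n => by simp [update, dualStep]⟩

theorem feasible_iterate (h : Q.Regular F G η r R) (fb : Feedback) (p : BanSaPParams)
    {x₁ : Vec d} (hx : x₁ ∈ (1 - p.γ) • Q.X) (v : ℕ → UnitSphere d) (t : ℕ) :
    Q.Feasible p.γ (Q.iterate fb p x₁ v t) := by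
  cases t with
  | zero => exact ⟨hx, fun n => by simp [iterate]⟩
  | succ t => exact h.feasible_update fb p t _ _

/-- The one-step inequality for the potential. -/
theorem potential_update_le (h : Q.Regular F G η r R) (fb : Feedback) {a δ : ℝ} (ha : 0 ≤ a)
    (hδ : 0 ≤ δ) (hδr : δ / r ≤ 1) (t : ℕ) {s : Vec d × Vec N} (hs : Q.Feasible (δ / r) s)
    (v : UnitSphere d) {z : Vec d} (hz : z ∈ (1 - δ / r) • Q.X) :
    potential z (Q.update fb (coupledParams r a δ) t s v) ≤ potential z s
      + a * inner ℝ (fb.gradEst (Q.f t) δ s.1 v) (z - s.1)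
      + a * ∑ n, s.2 n * Q.truncLin (2 * R * G + η) t s.1 z n
      + a ^ 2 * ((‖fb.gradEst (Q.f t) δ s.1 v‖ ^ 2 + N * (4 * R * G + η) ^ 2) / 2) := by
  obtain ⟨x, l⟩ := s
  obtain ⟨hx, hl⟩ := hs
  simp only at hx hl ⊢
  have hγ0 : 0 ≤ 1 - δ / r := by linarith
  have hγ1 : 1 - δ / r ≤ 1 := by have := h.r_pos; linarith [show 0 ≤ δ / r by positivity]
  have hxX := h.smul_subset hγ0 hγ1 hx
  set ĝ := fb.gradEst (Q.f t) δ x v with hg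
  set y := ĝ + ∑ n, l n • ∇ (fun y => Q.g t y n) x with hy
  set p := proj ((1 - δ / r) • Q.X) (x - a • y) with hp
  have hpm : p ∈ (1 - δ / r) • Q.X := proj_mem (h.nonempty_smul _) (h.closed_smul _) _
  have hpX := h.smul_subset hγ0 hγ1 hpm
  have hupd1 : (Q.update fb (coupledParams r a δ) t (x, l) v).1 = p := rfl
  have hupd2 (n : Fin N) : (Q.update fb (coupledParams r a δ) t (x, l) v).2 n =
      max (l n + a * (Q.g t x n + inner ℝ (∇ (fun y => Q.g t y n) x) (p - x))) 0 := rfl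
  have h1 := norm_sub_proj_sq_le (h.nonempty_smul _) (h.closed_smul _) (h.convex_smul _) x (a • y)
    hz
  rw [← hp] at h1
  have hinner (w : Vec d) : inner ℝ (a • y) w = a * inner ℝ ĝ w +
      a * ∑ n, l n * inner ℝ (∇ (fun y => Q.g t y n) x) w := by
    rw [real_inner_smul_left, hy, inner_add_left, sum_inner, mul_add]
    simp only [real_inner_smul_left]
  have hdual : ‖(Q.update fb (coupledParams r a δ) t (x, l) v).2‖ ^ 2 / 2 ≤ ‖l‖ ^ 2 / 2 +
      a * ∑ n, l n * Q.truncLin (2 * R * G + η) t x p n +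
      a ^ 2 * (N * (4 * R * G + η) ^ 2 / 2) := by
    rw [EuclideanSpace.norm_sq_eq, EuclideanSpace.norm_sq_eq]
    simp only [Real.norm_eq_abs, sq_abs]
    have key (n : Fin N) : (Q.update fb (coupledParams r a δ) t (x, l) v).2 n ^ 2 ≤ l n ^ 2 +
        2 * a * (l n * Q.truncLin (2 * R * G + η) t x p n) + a ^ 2 * (4 * R * G + η) ^ 2 := by
      -- Raising the constraint value to the truncation level can only enlarge the positive part.
      have e1 : (Q.update fb (coupledParams r a δ) t (x, l) v).2 n ≤
          max (l n + a * Q.truncLin (2 * R * G + η) t x p n) 0 := by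
        rw [hupd2]
        unfold truncLin
        gcongr
        exact le_max_left _ _
      have e0 : 0 ≤ (Q.update fb (coupledParams r a δ) t (x, l) v).2 n := by
        rw [hupd2]; exact le_max_right _ _
      have e2 := h.abs_truncLin_le t hxX hpX n
      set c := Q.truncLin (2 * R * G + η) t x p n
      have e3 : (max (l n + a * c) 0) ^ 2 ≤ (l n + a * c) ^ 2 := by
        rcases max_cases (l n + a * c) 0 with ⟨e, _⟩ | ⟨e, _⟩ <;> rw [e]
        simpa using sq_nonneg (l n + a * c)
      have e4 : c ^ 2 ≤ (4 * R * G + η) ^ 2 := sq_le_sq' (by linarith [abs_le.1 e2]) (abs_le.1 e2).2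
      have e5 : a ^ 2 * c ^ 2 ≤ a ^ 2 * (4 * R * G + η) ^ 2 := by gcongr
      have e6 := pow_le_pow_left₀ e0 e1 2
      nlinarith
    have := Finset.sum_le_sum fun n (_ : n ∈ Finset.univ) => key n
    simp only [Finset.sum_add_distrib, Finset.sum_const, Finset.card_univ, Fintype.card_fin,
      nsmul_eq_mul, ← Finset.mul_sum] at this
    linarith
  -- Young's inequality; the square of the step is paid for by the negative term of the projection
  -- inequality.
  have hcs : - (a * inner ℝ ĝ (p - x)) ≤ a ^ 2 * (‖ĝ‖ ^ 2 / 2) + ‖p - x‖ ^ 2 / 2 := by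
    have e1 := abs_real_inner_le_norm ĝ (p - x)
    have e2 : a * |inner ℝ ĝ (p - x)| ≤ a * (‖ĝ‖ * ‖p - x‖) := by gcongr
    have e3 : a * -inner ℝ ĝ (p - x) ≤ a * |inner ℝ ĝ (p - x)| := by
      gcongr; exact neg_le_abs _
    nlinarith [sq_nonneg (a * ‖ĝ‖ - ‖p - x‖)]
  -- The two sums of gradient terms cancel against those of the primal step, because primal and dual
  -- step sizes agree and the dual step uses the new point `p`.
  have hlin : ∑ n, l n * Q.truncLin (2 * R * G + η) t x p n =
      ∑ n, l n * Q.truncLin (2 * R * G + η) t x z n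
      - ∑ n, l n * inner ℝ (∇ (fun y => Q.g t y n) x) (z - x)
      + ∑ n, l n * inner ℝ (∇ (fun y => Q.g t y n) x) (p - x) := by
    rw [← Finset.sum_sub_distrib, ← Finset.sum_add_distrib]
    refine Finset.sum_congr rfl fun n _ => ?_
    unfold truncLin
    ring
  rw [hlin] at hdual
  rw [hinner, hinner] at h1
  unfold potential
  rw [hupd1]
  simp only
  nlinarith

/-- Comparison with a Slater point. -/
theorem potential_update_le_slater (h : Q.Regular F G η r R) (fb : Feedback) {a δ B : ℝ}
    (ha : 0 ≤ a) (hδ : 0 ≤ δ) (hδr : δ / r ≤ 1) (t : ℕ) {s : Vec d × Vec N}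
    (hs : Q.Feasible (δ / r) s) (v : UnitSphere d) {z : Vec d} (hz : z ∈ (1 - δ / r) • Q.X)
    (hzg : ∀ n, Q.g t z n ≤ -η) (hB : ‖fb.gradEst (Q.f t) δ s.1 v‖ ≤ B) :
    potential z (Q.update fb (coupledParams r a δ) t s v) ≤ potential z s
      + a * inner ℝ (fb.gradEst (Q.f t) δ s.1 v) (z - s.1)
      - a * η * ∑ n, s.2 n + a ^ 2 * ((B ^ 2 + N * (4 * R * G + η) ^ 2) / 2) := by
  have h0 := h.potential_update_le fb ha hδ hδr t hs v hz
  have hγ0 : 0 ≤ 1 - δ / r := by linarith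
  have hγ1 : 1 - δ / r ≤ 1 := by have := h.r_pos; linarith [show 0 ≤ δ / r by positivity]
  have h1 : ∑ n, s.2 n * Q.truncLin (2 * R * G + η) t s.1 z n ≤ ∑ n, s.2 n * (-η) := by
    refine Finset.sum_le_sum fun n _ => mul_le_mul_of_nonneg_left ?_ (hs.2 n)
    refine (h.truncLin_le t (h.smul_subset hγ0 hγ1 hs.1) (h.smul_subset hγ0 hγ1 hz) n).trans ?_
    exact max_le (hzg n) le_rfl
  rw [← Finset.sum_mul] at h1
  have h2 : a * ∑ n, s.2 n * Q.truncLin (2 * R * G + η) t s.1 z n ≤ a * ((∑ n, s.2 n) * -η) := by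
    gcongr
  have h3 : a ^ 2 * ((‖fb.gradEst (Q.f t) δ s.1 v‖ ^ 2 + N * (4 * R * G + η) ^ 2) / 2) ≤
      a ^ 2 * ((B ^ 2 + N * (4 * R * G + η) ^ 2) / 2) := by gcongr
  linarith

/-- Comparison with a shrunken feasible point of the slot problem. -/
theorem potential_update_le_feasible (h : Q.Regular F G η r R) (fb : Feedback) {a δ B : ℝ}
    (ha : 0 ≤ a) (hδ : 0 ≤ δ) (hδr : δ / r ≤ 1) (t : ℕ) {s : Vec d × Vec N}
    (hs : Q.Feasible (δ / r) s) (v : UnitSphere d) {y : Vec d} (hy : y ∈ Q.X)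
    (hyg : ∀ n, Q.g t y n ≤ 0) (hB : ‖fb.gradEst (Q.f t) δ s.1 v‖ ≤ B) :
    potential ((1 - δ / r) • y) (Q.update fb (coupledParams r a δ) t s v) ≤
      potential ((1 - δ / r) • y) s
      + a * inner ℝ (fb.gradEst (Q.f t) δ s.1 v) ((1 - δ / r) • y - s.1)
      + a * (G * (δ / r) * R) * ∑ n, s.2 n
      + a ^ 2 * ((B ^ 2 + N * (4 * R * G + η) ^ 2) / 2) := by
  have hz : (1 - δ / r) • y ∈ (1 - δ / r) • Q.X := Set.smul_mem_smul_set hy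
  have h0 := h.potential_update_le fb ha hδ hδr t hs v hz
  have hγ0 : 0 ≤ 1 - δ / r := by linarith
  have hr := h.r_pos
  have hγ : 0 ≤ δ / r := by positivity
  have hγ1 : 1 - δ / r ≤ 1 := by linarith
  have hG := h.G_nonneg
  have hR := h.R_pos
  have h1 : ∑ n, s.2 n * Q.truncLin (2 * R * G + η) t s.1 ((1 - δ / r) • y) n ≤
      ∑ n, s.2 n * (G * (δ / r) * R) := by
    refine Finset.sum_le_sum fun n _ => mul_le_mul_of_nonneg_left ?_ (hs.2 n)
    refine (h.truncLin_le t (h.smul_subset hγ0 hγ1 hs.1) (h.smul_subset hγ0 hγ1 hz) n).trans ?_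
    refine max_le ?_ (by have := h.eta_pos; linarith [show 0 ≤ G * (δ / r) * R by positivity])
    -- Shrinking moves `y` by at most `δ / r * R`, so a feasible point may violate a constraint by
    -- at most `G` times this.
    have e1 := h.g_sub_le t n (h.smul_subset hγ0 hγ1 hz) y
    have e2 : ‖(1 - δ / r) • y - y‖ = δ / r * ‖y‖ := by
      have : (1 - δ / r) • y - y = -((δ / r) • y) := by module
      rw [this, norm_neg, norm_smul, Real.norm_eq_abs, abs_of_nonneg hγ]
    rw [e2] at e1
    have e3 : G * (δ / r * ‖y‖) ≤ G * (δ / r * R) := by gcongr; exact h.norm_le hy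
    linarith [hyg n]
  rw [← Finset.sum_mul] at h1
  have h2 : a * ∑ n, s.2 n * Q.truncLin (2 * R * G + η) t s.1 ((1 - δ / r) • y) n ≤
      a * ((∑ n, s.2 n) * (G * (δ / r) * R)) := by gcongr
  have h3 : a ^ 2 * ((‖fb.gradEst (Q.f t) δ s.1 v‖ ^ 2 + N * (4 * R * G + η) ^ 2) / 2) ≤
      a ^ 2 * ((B ^ 2 + N * (4 * R * G + η) ^ 2) / 2) := by gcongr
  linarith

/-! ### The gradient estimates -/

theorem norm_gradEst_one_le (h : Q.Regular F G η r R) {δ : ℝ} (hδ : 0 < δ) (hδr : δ / r ≤ 1)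
    (t : ℕ) {x : Vec d} (hx : x ∈ (1 - δ / r) • Q.X) (v : UnitSphere d) :
    ‖Feedback.one.gradEst (Q.f t) δ x v‖ ≤ d * F / δ := by
  have h1 := h.bound_f t _ (h.add_smul_mem hδ.le hδr hx (norm_unitSphere v))
  simp only [Feedback.gradEst]
  rw [norm_smul, norm_unitSphere, mul_one, Real.norm_eq_abs, abs_mul,
    abs_of_nonneg (show (0 : ℝ) ≤ d / δ by positivity)]
  calc (d : ℝ) / δ * |Q.f t (x + δ • (v : Vec d))| ≤ d / δ * F := by gcongr
    _ = _ := by ring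

/-- The Lipschitz bound on the difference cancels the factor `1 / δ`. Being uniform in `δ`, the
bound permits a deterministic control of the dual iterates. -/
theorem norm_gradEst_two_le (h : Q.Regular F G η r R) {δ : ℝ} (hδ : 0 < δ) (hδr : δ / r ≤ 1)
    (t : ℕ) {x : Vec d} (hx : x ∈ (1 - δ / r) • Q.X) (v : UnitSphere d) :
    ‖Feedback.two.gradEst (Q.f t) δ x v‖ ≤ d * G := by
  have hp := h.add_smul_mem hδ.le hδr hx (norm_unitSphere v)
  have hm := h.sub_smul_mem hδ.le hδr hx (norm_unitSphere v)
  have h1 := h.f_sub_le t hp (x - δ • (v : Vec d))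
  have h2 := h.f_sub_le t hm (x + δ • (v : Vec d))
  have h3 : ‖x + δ • (v : Vec d) - (x - δ • (v : Vec d))‖ = 2 * δ := by
    have : x + δ • (v : Vec d) - (x - δ • (v : Vec d)) = (2 * δ) • (v : Vec d) := by module
    rw [this, norm_smul, norm_unitSphere, mul_one, Real.norm_eq_abs, abs_of_pos (by positivity)]
  rw [norm_sub_rev, h3] at h2
  rw [h3] at h1
  simp only [Feedback.gradEst]
  rw [norm_smul, norm_unitSphere, mul_one, Real.norm_eq_abs, abs_mul,
    abs_of_nonneg (show (0 : ℝ) ≤ d / (2 * δ) by positivity)]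
  calc (d : ℝ) / (2 * δ) * |Q.f t (x + δ • (v : Vec d)) - Q.f t (x - δ • (v : Vec d))|
      ≤ d / (2 * δ) * (G * (2 * δ)) := by
        gcongr
        rw [abs_le]
        exact ⟨by linarith, by linarith⟩
    _ = _ := by field_simp

/-- In expectation the gradient estimates are approximate subgradients. -/
theorem integral_gradEst_le (hd : 0 < d) (h : Q.Regular F G η r R) (fb : Feedback) {δ : ℝ}
    (hδ : 0 < δ) (hδr : δ / r ≤ 1) (t : ℕ) {x z : Vec d} (hx : x ∈ (1 - δ / r) • Q.X)
    (hz : z ∈ (1 - δ / r) • Q.X) :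
    ∫ v, inner ℝ (fb.gradEst (Q.f t) δ x v) (z - x) ∂uniformSphere d ≤
      Q.f t z - Q.f t x + 2 * δ * G := by
  have hfc := continuous_of_convexOn_univ (h.convex_f t)
  have hG := h.G_nonneg
  have hγ0 : 0 ≤ 1 - δ / r := by linarith
  have hγ1 : 1 - δ / r ≤ 1 := by have := h.r_pos; linarith [show 0 ≤ δ / r by positivity]
  have hxX := h.smul_subset hγ0 hγ1 hx
  have one : ∫ v : UnitSphere d, (d : ℝ) / δ * Q.f t (x + δ • (v : Vec d)) *
      inner ℝ (v : Vec d) (z - x) ∂uniformSphere d ≤ Q.f t z - Q.f t x + 2 * δ * G := by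
    refine integral_sphere_inner_le hd (h.convex_f t) hδ (fun hw => ?_) fun v => ?_
    · rw [sub_eq_zero.1 hw]
      have : 0 ≤ 2 * δ * G := by positivity
      linarith
    -- Both endpoints are displaced by a vector of length `δ`, each at a cost of `δ * G`.
    · have e1 := h.f_sub_le t (h.add_smul_mem hδ.le hδr hz (norm_unitSphere v)) z
      have e2 := h.f_sub_le t hxX (x + δ • (v : Vec d))
      have e3 : ‖z + δ • (v : Vec d) - z‖ = δ := by
        rw [add_sub_cancel_left, norm_smul, norm_unitSphere, mul_one, Real.norm_eq_abs,
          abs_of_pos hδ]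
      have e4 : ‖x - (x + δ • (v : Vec d))‖ = δ := by
        rw [sub_add_cancel_left, norm_neg, norm_smul, norm_unitSphere, mul_one, Real.norm_eq_abs,
          abs_of_pos hδ]
      have e5 : x + δ • (v : Vec d) + (z - x) = z + δ • (v : Vec d) := by abel
      rw [e3] at e1
      rw [e4] at e2
      rw [e5]
      linarith
  cases fb with
  | one =>
    refine le_trans (le_of_eq ?_) one
    congr 1; ext v
    simp only [Feedback.gradEst, real_inner_smul_left]
  | two =>
    refine le_trans (le_of_eq ?_) one
    set φ : UnitSphere d → ℝ := fun v => (d : ℝ) / δ * Q.f t (x + δ • (v : Vec d)) *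
      inner ℝ (v : Vec d) (z - x) with hφ
    have hφc : Continuous φ := by fun_prop
    -- The two-point estimate is the average of the one-point estimates in the directions `v` and
    -- `-v`, so it has the same mean.
    set A : Vec d ≃ₗᵢ[ℝ] Vec d := LinearIsometryEquiv.neg ℝ
    have hφA : Integrable (fun v => φ (sphereMap A v)) (uniformSphere d) :=
      integrable_sphere hd (hφc.comp (continuous_sphereMap A))
    have e1 (v : UnitSphere d) : inner ℝ (Feedback.two.gradEst (Q.f t) δ x v) (z - x) =
        1 / 2 * (φ v + φ (sphereMap A v)) := by
      simp only [Feedback.gradEst, real_inner_smul_left, hφ, sphereMap, A,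
        LinearIsometryEquiv.coe_neg, smul_neg, inner_neg_left, ← sub_eq_add_neg]
      field_simp
      ring
    simp only [e1]
    rw [integral_const_mul, integral_add (integrable_sphere hd hφc) hφA, integral_sphereMap A hφc]
    ring

end Regular

end OnlineProblem

/-! ### Sequences of independent uniform directions -/

/-- The law of a sequence of independent uniform directions. -/
noncomputable def sphereSeq (d : ℕ) : Measure (ℕ → UnitSphere d) :=
  Measure.infinitePi fun _ => uniformSphere d

theorem isProbabilityMeasure_sphereSeq {d : ℕ} (hd : 0 < d) :
    IsProbabilityMeasure (sphereSeq d) := by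
  have := isProbabilityMeasure_uniformSphere hd
  unfold sphereSeq
  infer_instance

/-- All quantities of a run depend on the directions alone, so this law reduces every estimate to
the product space of direction sequences. -/
theorem IsUniformIID.hasLaw {d : ℕ} {Ω : Type*} [MeasurableSpace Ω] {P : Measure Ω}
    {u : ℕ → Ω → UnitSphere d} (h : IsUniformIID P u) :
    HasLaw (fun ω s => u s ω) (sphereSeq d) P :=
  h.1.hasLaw_infinitePi h.2 (aemeasurable_pi_iff.2 fun t => (h.2 t).aemeasurable)

theorem isUniformIID_eval {d : ℕ} (hd : 0 < d) :
    IsUniformIID (sphereSeq d) (fun t (v : ℕ → UnitSphere d) => v t) := by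
  have := isProbabilityMeasure_uniformSphere hd
  refine ⟨iIndepFun_infinitePi (X := fun _ v => v) fun _ => measurable_id, fun t =>
    ⟨(measurable_pi_apply t).aemeasurable, ?_⟩⟩
  exact Measure.infinitePi_map_eval _ t

/-! ### Measurability -/

/-- The derivative is a measurable function of the point for every `f`, which covers points outside
`X`, where differentiability is not assumed. -/
theorem measurable_gradient {d : ℕ} (f : Vec d → ℝ) : Measurable (∇ f) := by
  unfold gradient
  exact (InnerProductSpace.toDual ℝ (Vec d)).symm.continuous.measurable.comp (measurable_fderiv ℝ f)

namespace Feedback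

theorem continuous_gradEst {d : ℕ} (fb : Feedback) {f : Vec d → ℝ} (hf : Continuous f) (δ : ℝ) :
    Continuous fun q : Vec d × UnitSphere d => fb.gradEst f δ q.1 q.2 := by
  cases fb <;> (simp only [gradEst]; fun_prop)

theorem continuous_query {d : ℕ} (fb : Feedback) (δ : ℝ) (m : Fin fb.M) :
    Continuous fun q : Vec d × UnitSphere d => fb.query δ q.1 q.2 m := by
  cases fb with
  | one =>
    change Fin 1 at m
    fin_cases m
    simp only [query]
    simp
    fun_prop
  | two =>
    change Fin 2 at m
    fin_cases m <;> (simp only [query]; simp; fun_prop)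

theorem query_eq {d : ℕ} (fb : Feedback) (δ : ℝ) (x : Vec d) (v : UnitSphere d) (m : Fin fb.M) :
    fb.query δ x v m = x + δ • (v : Vec d) ∨ fb.query δ x v m = x - δ • (v : Vec d) := by
  cases fb with
  | one =>
    change Fin 1 at m
    fin_cases m
    exact .inl rfl
  | two =>
    change Fin 2 at m
    fin_cases m
    · exact .inl rfl
    · exact .inr rfl

theorem M_pos (fb : Feedback) : 0 < fb.M := by cases fb <;> simp [M]

end Feedback

namespace OnlineProblem

variable {d N : ℕ} {Q : OnlineProblem d N} {F G η r R : ℝ}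

theorem continuous_potential (z : Vec d) :
    Continuous fun s : Vec d × Vec N => potential z s := by
  unfold potential; fun_prop

namespace Regular

theorem measurable_update (h : Q.Regular F G η r R) (fb : Feedback) (p : BanSaPParams) (t : ℕ) :
    Measurable fun q : (Vec d × Vec N) × UnitSphere d => Q.update fb p t q.1 q.2 := by
  have hproj := (continuous_proj (h.nonempty_smul (1 - p.γ)) (h.closed_smul _)
    (h.convex_smul _)).measurable
  have hgrad := (fb.continuous_gradEst (continuous_of_convexOn_univ (h.convex_f t)) p.δ).measurable
  have hg (n : Fin N) : Measurable fun x => Q.g t x n :=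
    (continuous_of_convexOn_univ (h.convex_g t n)).measurable
  have hgg (n : Fin N) := measurable_gradient fun x => Q.g t x n
  have hl (n : Fin N) : Measurable fun l : Vec N => l n := by fun_prop
  have h1 : Measurable fun q : (Vec d × Vec N) × UnitSphere d =>
      Q.primalStep fb p t q.1.1 q.1.2 q.2 := by
    have h2 : Measurable fun q : (Vec d × Vec N) × UnitSphere d =>
        Q.lagrangianGradEst fb p.δ t q.1.1 q.1.2 q.2 := by
      unfold lagrangianGradEst
      refine (hgrad.comp (measurable_fst.fst.prodMk measurable_snd)).add
        (Finset.measurable_sum _ fun n _ => ?_)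
      exact ((hl n).comp measurable_fst.snd).smul ((hgg n).comp measurable_fst.fst)
    have h3 : Measurable fun q : (Vec d × Vec N) × UnitSphere d =>
        p.α • Q.lagrangianGradEst fb p.δ t q.1.1 q.1.2 q.2 := h2.const_smul p.α
    exact hproj.comp (measurable_fst.fst.sub h3)
  refine h1.prodMk ?_
  unfold dualStep
  refine (WithLp.measurable_toLp 2 _).comp (measurable_pi_iff.2 fun n => ?_)
  refine Measurable.max (((hl n).comp measurable_fst.snd).add (Measurable.const_mul ?_ _))
    measurable_const
  exact ((hg n).comp measurable_fst.fst).add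
    (((hgg n).comp measurable_fst.fst).inner (h1.sub measurable_fst.fst))

theorem measurable_iterate (h : Q.Regular F G η r R) (fb : Feedback) (p : BanSaPParams)
    (x₁ : Vec d) (t : ℕ) : Measurable fun v => Q.iterate fb p x₁ v t := by
  induction t with
  | zero => exact measurable_const (a := (x₁, (0 : Vec N)))
  | succ t ih =>
    have h1 : Measurable fun v : ℕ → UnitSphere d => (Q.iterate fb p x₁ v t, v t) :=
      ih.prodMk (measurable_pi_apply t)
    have h2 := (h.measurable_update fb p t).comp h1
    have h3 : (fun v => Q.iterate fb p x₁ v (t + 1)) =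
        (fun q : (Vec d × Vec N) × UnitSphere d => Q.update fb p t q.1 q.2) ∘
        fun v : ℕ → UnitSphere d => (Q.iterate fb p x₁ v t, v t) := by
      ext1 v
      rw [iterate_succ, Function.comp_apply]
    rw [h3]
    exact h2

theorem measurable_action (h : Q.Regular F G η r R) (fb : Feedback) (p : BanSaPParams)
    (x₁ : Vec d) (t : ℕ) (m : Fin fb.M) : Measurable fun v => Q.action fb p x₁ v t m :=
  (fb.continuous_query p.δ m).measurable.comp
    ((h.measurable_iterate fb p x₁ t).fst.prodMk (measurable_pi_apply t))

theorem measurable_fit (h : Q.Regular F G η r R) (fb : Feedback) (p : BanSaPParams)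
    (x₁ : Vec d) (T : ℕ) : Measurable fun v => Q.fit fb p x₁ v T := by
  unfold fit
  refine ((WithLp.measurable_toLp 2 _).comp (measurable_pi_iff.2 fun n => ?_)).norm
  refine Measurable.max (Measurable.const_mul ?_ _) measurable_const
  refine Finset.measurable_sum _ fun t _ => Finset.measurable_sum _ fun m _ => ?_
  exact (continuous_of_convexOn_univ (h.convex_g t n)).measurable.comp
    (h.measurable_action fb p x₁ t m)

end Regular

/-! ### Independence of the state and the current direction -/

theorem iterate_congr (fb : Feedback) (p : BanSaPParams) (x₁ : Vec d) {v w : ℕ → UnitSphere d}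
    {t : ℕ} (hvw : ∀ s < t, v s = w s) : Q.iterate fb p x₁ v t = Q.iterate fb p x₁ w t := by
  induction t with
  | zero => rfl
  | succ t ih =>
    rw [iterate_succ, iterate_succ, ih fun s hs => hvw s (by lia), hvw t (by lia)]

namespace Regular

/-- The state at the beginning of a slot is independent of the direction in that slot. -/
theorem map_iterate_prod (hd : 0 < d) (h : Q.Regular F G η r R) (fb : Feedback)
    (p : BanSaPParams) (x₁ : Vec d) (t : ℕ) :
    (sphereSeq d).map (fun v => (Q.iterate fb p x₁ v t, v t)) =
      ((sphereSeq d).map fun v => Q.iterate fb p x₁ v t).prod (uniformSphere d) := by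
  have := isProbabilityMeasure_sphereSeq hd
  have hm := h.measurable_iterate fb p x₁ t
  obtain ⟨hind, hlaw⟩ := isUniformIID_eval hd
  obtain ⟨e⟩ := nonempty_unitSphere hd
  have hdisj : Disjoint (Finset.range t) {t} := by simp
  have hif := hind.indepFun_finset (Finset.range t) {t} hdisj fun s => measurable_pi_apply s
  -- The first `t` directions are padded with an arbitrary `e`. The state at slot `t` reads only
  -- those `t` directions, so it factors through them.
  set ext : ((Finset.range t) → UnitSphere d) → ℕ → UnitSphere d :=
    fun w s => if hs : s ∈ Finset.range t then w ⟨s, hs⟩ else e with hext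
  have hextm : Measurable ext := by
    refine measurable_pi_iff.2 fun s => ?_
    by_cases hs : s ∈ Finset.range t
    · simp only [hext, hs, dite_true]; exact measurable_pi_apply _
    · simp only [hext, hs, dite_false]; exact measurable_const
  have h1 := hif.comp (hm.comp hextm)
    (measurable_pi_apply (⟨t, Finset.mem_singleton_self t⟩ : ({t} : Finset ℕ)))
  have h2 : IndepFun (fun v => Q.iterate fb p x₁ v t) (fun v : ℕ → UnitSphere d => v t)
      (sphereSeq d) := by
    have h2 : (fun v => Q.iterate fb p x₁ v t) = (((fun v => Q.iterate fb p x₁ v t) ∘ ext) ∘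
        fun a (i : Finset.range t) => a ↑i) := by
      ext1 v
      refine iterate_congr fb p x₁ fun s hs => ?_
      simp [hext, hs]
    rw [h2]
    exact h1
  rw [h2.map_prod_eq_prod_map_map hm.aemeasurable (measurable_pi_apply t).aemeasurable,
    (hlaw t).map_eq]

/-- Integration over the direction of the current slot first. -/
theorem integral_iterate_le (hd : 0 < d) (h : Q.Regular F G η r R) (fb : Feedback)
    (p : BanSaPParams) {x₁ : Vec d} (hx : x₁ ∈ (1 - p.γ) • Q.X) (t : ℕ)
    {φ : (Vec d × Vec N) × UnitSphere d → ℝ} (hφ : Measurable φ)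
    (hint : Integrable (fun v => φ (Q.iterate fb p x₁ v t, v t)) (sphereSeq d))
    {ψ : Vec d × Vec N → ℝ}
    (hψ : ∀ s, Q.Feasible p.γ s → ∫ v, φ (s, v) ∂uniformSphere d ≤ ψ s)
    (hψint : Integrable (fun v => ψ (Q.iterate fb p x₁ v t)) (sphereSeq d)) :
    ∫ v, φ (Q.iterate fb p x₁ v t, v t) ∂sphereSeq d ≤
      ∫ v, ψ (Q.iterate fb p x₁ v t) ∂sphereSeq d := by
  have := isProbabilityMeasure_sphereSeq hd
  have := isProbabilityMeasure_uniformSphere hd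
  have hm := h.measurable_iterate fb p x₁ t
  have hm2 : Measurable fun v => (Q.iterate fb p x₁ v t, v t) := hm.prodMk (measurable_pi_apply t)
  have : IsProbabilityMeasure ((sphereSeq d).map fun v => Q.iterate fb p x₁ v t) :=
    Measure.isProbabilityMeasure_map hm.aemeasurable
  have hint' : Integrable φ (((sphereSeq d).map fun v => Q.iterate fb p x₁ v t).prod
      (uniformSphere d)) := by
    rw [← h.map_iterate_prod hd]
    exact (integrable_map_measure hφ.aestronglyMeasurable hm2.aemeasurable).2 hint
  have hI : StronglyMeasurable fun s => ∫ v, φ (s, v) ∂uniformSphere d :=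
    hφ.stronglyMeasurable.integral_prod_right'
  have hIint : Integrable (fun v => ∫ w, φ (Q.iterate fb p x₁ v t, w) ∂uniformSphere d)
      (sphereSeq d) :=
    (integrable_map_measure hI.aestronglyMeasurable hm.aemeasurable).1 hint'.integral_prod_left
  calc ∫ v, φ (Q.iterate fb p x₁ v t, v t) ∂sphereSeq d
      = ∫ q, φ q ∂((sphereSeq d).map fun v => (Q.iterate fb p x₁ v t, v t)) :=
        (integral_map hm2.aemeasurable hφ.aestronglyMeasurable).symm
    _ = ∫ s, ∫ v, φ (s, v) ∂uniformSphere d ∂((sphereSeq d).map fun v =>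
          Q.iterate fb p x₁ v t) := by
        rw [h.map_iterate_prod hd, integral_prod _ hint']
    _ = ∫ v, ∫ w, φ (Q.iterate fb p x₁ v t, w) ∂uniformSphere d ∂sphereSeq d :=
        integral_map hm.aemeasurable hI.aestronglyMeasurable
    _ ≤ _ := integral_mono hIint hψint fun v => hψ _ (h.feasible_iterate fb p hx v t)

end Regular

end OnlineProblem

/-! ### Expected potential and regret of a single run -/

namespace OnlineProblem

variable {d N : ℕ} {Q : OnlineProblem d N} {F G η r R : ℝ}

/-- The second-order constant of the one-step inequality for gradient estimates of norm at
most `B`. -/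
noncomputable def stepConst (N : ℕ) (G η R B : ℝ) : ℝ := (B ^ 2 + N * (4 * R * G + η) ^ 2) / 2

theorem stepConst_nonneg (N : ℕ) (G η R B : ℝ) : 0 ≤ stepConst N G η R B := by
  unfold stepConst; positivity

/-- A run with coupled step size `a` and perturbation `δ` whose gradient estimates are bounded
by `B`, together with a Slater point `z` of the shrunken set. -/
structure RunBounds (Q : OnlineProblem d N) (fb : Feedback) (η r a δ B : ℝ) (x₁ z : Vec d) :
    Prop where
  a_pos : 0 < a
  δ_pos : 0 < δ
  δ_le : δ / r ≤ 1
  norm_gradEst_le : ∀ t, ∀ x ∈ (1 - δ / r) • Q.X, ∀ v, ‖fb.gradEst (Q.f t) δ x v‖ ≤ B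
  init : x₁ ∈ (1 - δ / r) • Q.X
  slater_mem : z ∈ (1 - δ / r) • Q.X
  slater_le : ∀ t n, Q.g t z n ≤ -η

namespace RunBounds

variable {fb : Feedback} {a δ B : ℝ} {x₁ z : Vec d}

theorem B_nonneg (hd : 0 < d) (H : Q.RunBounds fb η r a δ B x₁ z) : 0 ≤ B := by
  obtain ⟨e⟩ := nonempty_unitSphere hd
  exact (norm_nonneg _).trans (H.norm_gradEst_le 0 _ H.init e)

theorem shrunken_subset (h : Q.Regular F G η r R) (H : Q.RunBounds fb η r a δ B x₁ z) :
    (1 - δ / r) • Q.X ⊆ Q.X := by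
  refine h.smul_subset (by linarith [H.δ_le]) ?_
  have := h.r_pos
  have := H.δ_pos
  linarith [show 0 ≤ δ / r by positivity]

theorem feasible (h : Q.Regular F G η r R) (H : Q.RunBounds fb η r a δ B x₁ z)
    (v : ℕ → UnitSphere d) (t : ℕ) :
    Q.Feasible (δ / r) (Q.iterate fb (coupledParams r a δ) x₁ v t) :=
  h.feasible_iterate fb (coupledParams r a δ) H.init v t

theorem iterate_mem (h : Q.Regular F G η r R) (H : Q.RunBounds fb η r a δ B x₁ z)
    (v : ℕ → UnitSphere d) (t : ℕ) : (Q.iterate fb (coupledParams r a δ) x₁ v t).1 ∈ Q.X :=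
  H.shrunken_subset h (H.feasible h v t).1

theorem abs_inner_gradEst_le (hd : 0 < d) (h : Q.Regular F G η r R)
    (H : Q.RunBounds fb η r a δ B x₁ z) (t : ℕ) {x y : Vec d} (hx : x ∈ (1 - δ / r) • Q.X)
    (hy : y ∈ (1 - δ / r) • Q.X) (v : UnitSphere d) :
    |inner ℝ (fb.gradEst (Q.f t) δ x v) (y - x)| ≤ 2 * R * B := by
  have h1 := abs_real_inner_le_norm (fb.gradEst (Q.f t) δ x v) (y - x)
  have h2 := h.norm_sub_le (H.shrunken_subset h hy) (H.shrunken_subset h hx)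
  have h3 := H.norm_gradEst_le t x hx v
  have h4 := H.B_nonneg hd
  calc _ ≤ _ := h1
    _ ≤ B * (2 * R) := by gcongr
    _ = _ := by ring

theorem potential_slater_update_le (h : Q.Regular F G η r R)
    (H : Q.RunBounds fb η r a δ B x₁ z) (t : ℕ) {s : Vec d × Vec N}
    (hs : Q.Feasible (δ / r) s) (v : UnitSphere d) :
    potential z (Q.update fb (coupledParams r a δ) t s v) ≤ potential z s
      + a * inner ℝ (fb.gradEst (Q.f t) δ s.1 v) (z - s.1)
      - a * η * ∑ n, s.2 n + a ^ 2 * stepConst N G η R B :=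
  h.potential_update_le_slater fb H.a_pos.le H.δ_pos.le H.δ_le t hs v H.slater_mem (H.slater_le t)
    (H.norm_gradEst_le t _ hs.1 v)

/-- Dropping the negative Slater drift leaves a worst-case increment that does not depend on the
dual iterate. -/
theorem potential_update_le_add (hd : 0 < d) (h : Q.Regular F G η r R)
    (H : Q.RunBounds fb η r a δ B x₁ z) (t : ℕ) {s : Vec d × Vec N}
    (hs : Q.Feasible (δ / r) s) (v : UnitSphere d) :
    potential z (Q.update fb (coupledParams r a δ) t s v) ≤ potential z s
      + (a * (2 * R * B) + a ^ 2 * stepConst N G η R B) := by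
  have h1 := H.potential_slater_update_le h t hs v
  have h2 : a * inner ℝ (fb.gradEst (Q.f t) δ s.1 v) (z - s.1) ≤ a * (2 * R * B) :=
    mul_le_mul_of_nonneg_left ((le_abs_self _).trans
      (H.abs_inner_gradEst_le hd h t hs.1 H.slater_mem v)) H.a_pos.le
  have h3 : 0 ≤ a * η * ∑ n, s.2 n :=
    mul_nonneg (mul_nonneg H.a_pos.le h.eta_pos.le) (Finset.sum_nonneg fun n _ => hs.2 n)
  linarith

theorem potential_init_le (h : Q.Regular F G η r R) (H : Q.RunBounds fb η r a δ B x₁ z)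
    {y : Vec d} (hy : y ∈ Q.X) (v : ℕ → UnitSphere d) :
    potential y (Q.iterate fb (coupledParams r a δ) x₁ v 0) ≤ 2 * R ^ 2 := by
  have h1 := h.norm_sub_le hy (H.shrunken_subset h H.init)
  have h2 := pow_le_pow_left₀ (norm_nonneg _) h1 2
  simp only [potential, iterate, norm_zero]
  linarith

/-- This bound grows linearly in `t`; it serves integrability and not the rates. -/
theorem potential_iterate_le (hd : 0 < d) (h : Q.Regular F G η r R)
    (H : Q.RunBounds fb η r a δ B x₁ z) (v : ℕ → UnitSphere d) (t : ℕ) :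
    potential z (Q.iterate fb (coupledParams r a δ) x₁ v t) ≤
      2 * R ^ 2 + t * (a * (2 * R * B) + a ^ 2 * stepConst N G η R B) := by
  induction t with
  | zero => simpa using H.potential_init_le h (H.shrunken_subset h H.slater_mem) v
  | succ t ih =>
    have := H.potential_update_le_add hd h t (H.feasible h v t) (v t)
    rw [iterate_succ]
    push_cast
    linarith

theorem integrable_potential (hd : 0 < d) (h : Q.Regular F G η r R)
    (H : Q.RunBounds fb η r a δ B x₁ z) {y : Vec d} (hy : y ∈ Q.X) (t : ℕ) :
    Integrable (fun v => potential y (Q.iterate fb (coupledParams r a δ) x₁ v t))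
      (sphereSeq d) := by
  have := isProbabilityMeasure_sphereSeq hd
  refine Integrable.of_bound (((continuous_potential y).measurable.comp
    (h.measurable_iterate fb _ x₁ t)).aestronglyMeasurable)
    ((2 * R ^ 2 + t * (a * (2 * R * B) + a ^ 2 * stepConst N G η R B)) + 2 * R ^ 2)
    (ae_of_all _ fun v => ?_)
  have h1 := H.potential_iterate_le hd h v t
  have h2 := pow_le_pow_left₀ (norm_nonneg _) (h.norm_sub_le hy (H.iterate_mem h v t)) 2
  have h3 := sq_nonneg ‖z - (Q.iterate fb (coupledParams r a δ) x₁ v t).1‖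
  rw [Real.norm_eq_abs, abs_of_nonneg (potential_nonneg _ _)]
  simp only [potential] at h1 ⊢
  linarith

theorem integrable_sum_dual (hd : 0 < d) (h : Q.Regular F G η r R)
    (H : Q.RunBounds fb η r a δ B x₁ z) (t : ℕ) :
    Integrable (fun v => ∑ n, (Q.iterate fb (coupledParams r a δ) x₁ v t).2 n)
      (sphereSeq d) := by
  have := isProbabilityMeasure_sphereSeq hd
  refine integrable_finsetSum _ fun n _ => ?_
  have hc : Continuous fun l : Vec N => l n := by fun_prop
  refine Integrable.of_bound ((hc.measurable.comp
    (h.measurable_iterate fb _ x₁ t).snd).aestronglyMeasurable)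
    (2 * (2 * R ^ 2 + t * (a * (2 * R * B) + a ^ 2 * stepConst N G η R B)) + 1)
    (ae_of_all _ fun v => ?_)
  have h1 := H.potential_iterate_le hd h v t
  have h2 := PiLp.norm_apply_le (Q.iterate fb (coupledParams r a δ) x₁ v t).2 n
  refine h2.trans ?_
  simp only [potential] at h1
  nlinarith [sq_nonneg ‖z - (Q.iterate fb (coupledParams r a δ) x₁ v t).1‖,
    sq_nonneg (‖(Q.iterate fb (coupledParams r a δ) x₁ v t).2‖ - 1)]

theorem integrable_f (hd : 0 < d) (h : Q.Regular F G η r R)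
    (H : Q.RunBounds fb η r a δ B x₁ z) (t : ℕ) :
    Integrable (fun v => Q.f t (Q.iterate fb (coupledParams r a δ) x₁ v t).1) (sphereSeq d) := by
  have := isProbabilityMeasure_sphereSeq hd
  refine Integrable.of_bound (((continuous_of_convexOn_univ (h.convex_f t)).measurable.comp
    (h.measurable_iterate fb _ x₁ t).fst).aestronglyMeasurable) F (ae_of_all _ fun v => ?_)
  exact h.bound_f t _ (H.iterate_mem h v t)

theorem measurable_inner_gradEst (h : Q.Regular F G η r R) (fb : Feedback) (δ : ℝ) (t : ℕ)
    (y : Vec d) : Measurable fun q : (Vec d × Vec N) × UnitSphere d =>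
      inner ℝ (fb.gradEst (Q.f t) δ q.1.1 q.2) (y - q.1.1) := by
  have hgrad := (fb.continuous_gradEst (continuous_of_convexOn_univ (h.convex_f t)) δ).measurable
  exact (hgrad.comp (measurable_fst.fst.prodMk measurable_snd)).inner
    (measurable_const.sub measurable_fst.fst)

theorem integrable_inner_gradEst (hd : 0 < d) (h : Q.Regular F G η r R)
    (H : Q.RunBounds fb η r a δ B x₁ z) {y : Vec d} (hy : y ∈ (1 - δ / r) • Q.X) (t : ℕ) :
    Integrable (fun v => inner ℝ
      (fb.gradEst (Q.f t) δ (Q.iterate fb (coupledParams r a δ) x₁ v t).1 (v t))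
      (y - (Q.iterate fb (coupledParams r a δ) x₁ v t).1)) (sphereSeq d) := by
  have := isProbabilityMeasure_sphereSeq hd
  refine Integrable.of_bound ((measurable_inner_gradEst h fb δ t y).comp
    ((h.measurable_iterate fb _ x₁ t).prodMk (measurable_pi_apply t))).aestronglyMeasurable
    (2 * R * B) (ae_of_all _ fun v => ?_)
  exact H.abs_inner_gradEst_le hd h t (H.feasible h v t).1 hy (v t)

theorem integral_inner_gradEst_le (hd : 0 < d) (h : Q.Regular F G η r R)
    (H : Q.RunBounds fb η r a δ B x₁ z) {y : Vec d} (hy : y ∈ (1 - δ / r) • Q.X) (t : ℕ) :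
    ∫ v, inner ℝ
      (fb.gradEst (Q.f t) δ (Q.iterate fb (coupledParams r a δ) x₁ v t).1 (v t))
      (y - (Q.iterate fb (coupledParams r a δ) x₁ v t).1) ∂sphereSeq d ≤
    Q.f t y - ∫ v, Q.f t (Q.iterate fb (coupledParams r a δ) x₁ v t).1 ∂sphereSeq d
      + 2 * δ * G := by
  have := isProbabilityMeasure_sphereSeq hd
  have hi := H.integrable_f hd h t
  have := h.integral_iterate_le hd fb (coupledParams r a δ) H.init t
    (measurable_inner_gradEst h fb δ t y) (H.integrable_inner_gradEst hd h hy t)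
    (ψ := fun s => Q.f t y - Q.f t s.1 + 2 * δ * G)
    (fun s hs => h.integral_gradEst_le hd fb H.δ_pos H.δ_le t hs.1 hy)
    (((integrable_const _).sub hi).add (integrable_const _))
  refine this.trans (le_of_eq ?_)
  have hs : Integrable (fun v => Q.f t y - Q.f t (Q.iterate fb (coupledParams r a δ) x₁ v t).1)
      (sphereSeq d) := (integrable_const _).sub hi
  rw [integral_add hs (integrable_const _), integral_sub (integrable_const _) hi]
  simp

/-- The one-step inequality in expectation. -/
theorem integral_potential_succ_le (hd : 0 < d) (h : Q.Regular F G η r R)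
    (H : Q.RunBounds fb η r a δ B x₁ z) {y : Vec d} (hy : y ∈ (1 - δ / r) • Q.X) (t : ℕ) {c : ℝ}
    (hc : ∀ s, Q.Feasible (δ / r) s → ∀ v,
      potential y (Q.update fb (coupledParams r a δ) t s v) ≤ potential y s
      + a * inner ℝ (fb.gradEst (Q.f t) δ s.1 v) (y - s.1)
      + a * c * ∑ n, s.2 n + a ^ 2 * stepConst N G η R B) :
    ∫ v, potential y (Q.iterate fb (coupledParams r a δ) x₁ v (t + 1)) ∂sphereSeq d ≤
      ∫ v, potential y (Q.iterate fb (coupledParams r a δ) x₁ v t) ∂sphereSeq d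
      + a * (Q.f t y - ∫ v, Q.f t (Q.iterate fb (coupledParams r a δ) x₁ v t).1 ∂sphereSeq d
        + 2 * δ * G)
      + a * c * ∫ v, ∑ n, (Q.iterate fb (coupledParams r a δ) x₁ v t).2 n ∂sphereSeq d
      + a ^ 2 * stepConst N G η R B := by
  have := isProbabilityMeasure_sphereSeq hd
  have hyX := H.shrunken_subset h hy
  have i1 := H.integrable_potential hd h hyX t
  have i2 := (H.integrable_inner_gradEst hd h hy t).const_mul a
  have i3 := (H.integrable_sum_dual hd h t).const_mul (a * c)
  have i12 : Integrable (fun v => potential y (Q.iterate fb (coupledParams r a δ) x₁ v t) +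
      a * inner ℝ (fb.gradEst (Q.f t) δ (Q.iterate fb (coupledParams r a δ) x₁ v t).1 (v t))
      (y - (Q.iterate fb (coupledParams r a δ) x₁ v t).1)) (sphereSeq d) := i1.add i2
  have i123 : Integrable (fun v => potential y (Q.iterate fb (coupledParams r a δ) x₁ v t) +
      a * inner ℝ (fb.gradEst (Q.f t) δ (Q.iterate fb (coupledParams r a δ) x₁ v t).1 (v t))
      (y - (Q.iterate fb (coupledParams r a δ) x₁ v t).1) +
      a * c * ∑ n, (Q.iterate fb (coupledParams r a δ) x₁ v t).2 n) (sphereSeq d) := i12.add i3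
  have h1 := integral_mono (H.integrable_potential hd h hyX (t + 1))
    (i123.add (integrable_const (a ^ 2 * stepConst N G η R B)))
    (fun v => hc _ (H.feasible h v t) (v t))
  have e := integral_add i123 (integrable_const (a ^ 2 * stepConst N G η R B))
  rw [integral_add i12 i3, integral_add i1 i2, integral_const_mul, integral_const_mul] at e
  simp only [integral_const, probReal_univ, one_smul] at e
  have h2 := mul_le_mul_of_nonneg_left (H.integral_inner_gradEst_le hd h hy t) H.a_pos.le
  refine h1.trans ?_
  simp only [Pi.add_apply] at e ⊢
  linarith

theorem abs_integral_f_le (hd : 0 < d) (h : Q.Regular F G η r R)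
    (H : Q.RunBounds fb η r a δ B x₁ z) (t : ℕ) :
    |∫ v, Q.f t (Q.iterate fb (coupledParams r a δ) x₁ v t).1 ∂sphereSeq d| ≤ F := by
  have := isProbabilityMeasure_sphereSeq hd
  have := norm_integral_le_of_norm_le_const (μ := sphereSeq d) (C := F)
    (f := fun v => Q.f t (Q.iterate fb (coupledParams r a δ) x₁ v t).1)
    (ae_of_all _ fun v => h.bound_f t _ (H.iterate_mem h v t))
  simpa using this

/-- The expected dual iterates are bounded on average. -/
theorem sum_integral_dual_le (hd : 0 < d) (h : Q.Regular F G η r R)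
    (H : Q.RunBounds fb η r a δ B x₁ z) (T : ℕ) :
    ∑ t ∈ Finset.range T,
      ∫ v, ∑ n, (Q.iterate fb (coupledParams r a δ) x₁ v t).2 n ∂sphereSeq d ≤
    (2 * R ^ 2 / a + T * (2 * F + 2 * δ * G + a * stepConst N G η R B)) / η := by
  have := isProbabilityMeasure_sphereSeq hd
  have hzX := H.shrunken_subset h H.slater_mem
  -- Telescoping at a fixed Slater point: each slot gains at most `2 * F` from the difference of the
  -- losses, and pays `η` times the expected sum of the multipliers.
  have key : ∫ v, potential z (Q.iterate fb (coupledParams r a δ) x₁ v T) ∂sphereSeq d +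
      a * η * ∑ t ∈ Finset.range T,
        ∫ v, ∑ n, (Q.iterate fb (coupledParams r a δ) x₁ v t).2 n ∂sphereSeq d ≤
      2 * R ^ 2 + T * (a * (2 * F + 2 * δ * G + a * stepConst N G η R B)) := by
    induction T with
    | zero =>
      have := integral_mono (H.integrable_potential hd h hzX 0)
        (integrable_const (2 * R ^ 2)) (fun v => H.potential_init_le h hzX v)
      simpa using this
    | succ T ih =>
      have h1 := H.integral_potential_succ_le hd h H.slater_mem T (c := -η) (fun s hs v => by
        have := H.potential_slater_update_le h T hs v
        linarith)
      have h2 := abs_le.1 (H.abs_integral_f_le hd h T)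
      have h3 := abs_le.1 (h.bound_f T z hzX)
      have h4 : a * (Q.f T z - ∫ v, Q.f T (Q.iterate fb (coupledParams r a δ) x₁ v T).1
          ∂sphereSeq d + 2 * δ * G) ≤ a * (2 * F + 2 * δ * G) :=
        mul_le_mul_of_nonneg_left (by linarith) H.a_pos.le
      rw [Finset.sum_range_succ]
      push_cast
      linarith
  have h1 : 0 ≤ ∫ v, potential z (Q.iterate fb (coupledParams r a δ) x₁ v T) ∂sphereSeq d :=
    integral_nonneg fun v => potential_nonneg _ _
  have ha := H.a_pos
  rw [le_div_iff₀ h.eta_pos]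
  have h2 : a * ((∑ t ∈ Finset.range T,
      ∫ v, ∑ n, (Q.iterate fb (coupledParams r a δ) x₁ v t).2 n ∂sphereSeq d) * η) ≤
      a * (2 * R ^ 2 / a + T * (2 * F + 2 * δ * G + a * stepConst N G η R B)) := by
    have : a * (2 * R ^ 2 / a + T * (2 * F + 2 * δ * G + a * stepConst N G η R B)) =
      2 * R ^ 2 + T * (a * (2 * F + 2 * δ * G + a * stepConst N G η R B)) := by
      field_simp
    rw [this]
    linarith
  exact le_of_mul_le_mul_left h2 ha

/-- On a set of diameter `2 * R`, half the squared distance is `2 * R`-Lipschitz in the comparator.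
-/
theorem potential_change_le (h : Q.Regular F G η r R) {s : Vec d × Vec N} (hs : s.1 ∈ Q.X)
    {y y' : Vec d} (hy : y ∈ Q.X) (hy' : y' ∈ Q.X) :
    potential y' s ≤ potential y s + 2 * R * ‖y' - y‖ := by
  have h1 : ‖y' - s.1‖ ≤ ‖y - s.1‖ + ‖y' - y‖ := by
    have := norm_add_le (y - s.1) (y' - y)
    rwa [show y - s.1 + (y' - y) = y' - s.1 by abel] at this
  have h2 := h.norm_sub_le hy hs
  have h3 := h.norm_sub_le hy' hs
  have h4 := norm_nonneg (y' - y)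
  have h5 := norm_nonneg (y' - s.1)
  have h6 := norm_nonneg (y - s.1)
  unfold potential
  nlinarith

/-- Accumulated expected losses of the iterates against the shrunken comparators. -/
theorem sum_integral_f_le (hd : 0 < d) (h : Q.Regular F G η r R)
    (H : Q.RunBounds fb η r a δ B x₁ z) {xs : ℕ → Vec d} (hxs : Q.IsSlotMinimizer xs) (T : ℕ) :
    ∑ t ∈ Finset.range T,
      ∫ v, Q.f t (Q.iterate fb (coupledParams r a δ) x₁ v t).1 ∂sphereSeq d ≤
    ∑ t ∈ Finset.range T, Q.f t ((1 - δ / r) • xs t)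
      + (2 * R ^ 2 + 2 * R * ∑ t ∈ Finset.range T, ‖xs (t + 1) - xs t‖) / a
      + T * (2 * δ * G + a * stepConst N G η R B)
      + G * (δ / r) * R * ∑ t ∈ Finset.range T,
        ∫ v, ∑ n, (Q.iterate fb (coupledParams r a δ) x₁ v t).2 n ∂sphereSeq d := by
  have := isProbabilityMeasure_sphereSeq hd
  have hr := h.r_pos
  have hR := h.R_pos
  have hδ := H.δ_pos
  have hδr := H.δ_le
  have hγ : 0 ≤ δ / r := by positivity
  have hK (t : ℕ) : (1 - δ / r) • xs t ∈ (1 - δ / r) • Q.X :=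
    Set.smul_mem_smul_set (hxs t).1.1
  have hX (t : ℕ) := H.shrunken_subset h (hK t)
  -- The comparator moves on after every slot, so after `T` slots the potential refers to `xs T`,
  -- one slot beyond the horizon. This makes the induction close and adds one increment to the
  -- variation.
  have key : ∫ v, potential ((1 - δ / r) • xs T)
      (Q.iterate fb (coupledParams r a δ) x₁ v T) ∂sphereSeq d +
      a * ∑ t ∈ Finset.range T,
        ∫ v, Q.f t (Q.iterate fb (coupledParams r a δ) x₁ v t).1 ∂sphereSeq d ≤
      a * ∑ t ∈ Finset.range T, Q.f t ((1 - δ / r) • xs t)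
      + (2 * R ^ 2 + 2 * R * ∑ t ∈ Finset.range T, ‖xs (t + 1) - xs t‖)
      + T * (a * (2 * δ * G + a * stepConst N G η R B))
      + a * (G * (δ / r) * R) * ∑ t ∈ Finset.range T,
        ∫ v, ∑ n, (Q.iterate fb (coupledParams r a δ) x₁ v t).2 n ∂sphereSeq d := by
    induction T with
    | zero =>
      have := integral_mono (H.integrable_potential hd h (hX 0) 0)
        (integrable_const (2 * R ^ 2)) (fun v => H.potential_init_le h (hX 0) v)
      simpa using this
    | succ T ih =>
      have h1 := H.integral_potential_succ_le hd h (hK T) T (c := G * (δ / r) * R)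
        (fun s hs v => h.potential_update_le_feasible fb H.a_pos.le hδ.le H.δ_le T hs v
          (hxs T).1.1 (hxs T).1.2 (H.norm_gradEst_le T _ hs.1 v))
      have h2 : ∫ v, potential ((1 - δ / r) • xs (T + 1))
          (Q.iterate fb (coupledParams r a δ) x₁ v (T + 1)) ∂sphereSeq d ≤
          ∫ v, potential ((1 - δ / r) • xs T)
          (Q.iterate fb (coupledParams r a δ) x₁ v (T + 1)) ∂sphereSeq d
          + 2 * R * ‖xs (T + 1) - xs T‖ := by
        have i1 := H.integrable_potential hd h (hX T) (T + 1)
        have := integral_mono (H.integrable_potential hd h (hX (T + 1)) (T + 1))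
          (i1.add (integrable_const (2 * R * ‖xs (T + 1) - xs T‖))) (fun v => by
            refine (potential_change_le h (H.iterate_mem h v (T + 1)) (hX T)
              (hX (T + 1))).trans ?_
            simp only [Pi.add_apply]
            gcongr
            rw [← smul_sub, norm_smul, Real.norm_eq_abs, abs_of_nonneg (by linarith)]
            exact mul_le_of_le_one_left (norm_nonneg _) (by linarith))
        refine this.trans (le_of_eq ?_)
        have e := integral_add i1 (integrable_const (2 * R * ‖xs (T + 1) - xs T‖))
        simpa only [Pi.add_apply, integral_const, probReal_univ, one_smul] using e
      simp only [Finset.sum_range_succ]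
      push_cast
      linarith
  have h1 : 0 ≤ ∫ v, potential ((1 - δ / r) • xs T)
      (Q.iterate fb (coupledParams r a δ) x₁ v T) ∂sphereSeq d :=
    integral_nonneg fun v => potential_nonneg _ _
  have ha := H.a_pos
  refine le_of_mul_le_mul_left ?_ ha
  have e : a * ((2 * R ^ 2 + 2 * R * ∑ t ∈ Finset.range T, ‖xs (t + 1) - xs t‖) / a) =
    2 * R ^ 2 + 2 * R * ∑ t ∈ Finset.range T, ‖xs (t + 1) - xs t‖ := by field_simp
  simp only [mul_add, e]
  linarith

/-- The telescoped sum has one increment more than `variation`, and the diameter bounds it. -/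
theorem sum_range_le_variation (h : Q.Regular F G η r R) {xs : ℕ → Vec d}
    (hxs : Q.IsSlotMinimizer xs) (T : ℕ) :
    ∑ t ∈ Finset.range T, ‖xs (t + 1) - xs t‖ ≤ variation xs T + 2 * R := by
  have hR := h.R_pos
  cases T with
  | zero => simp [variation]; positivity
  | succ T =>
    rw [Finset.sum_range_succ]
    simp only [variation, Nat.add_sub_cancel]
    linarith [h.norm_sub_le (hxs (T + 1)).1.1 (hxs T).1.1]

theorem action_mem (h : Q.Regular F G η r R) (H : Q.RunBounds fb η r a δ B x₁ z)
    (v : ℕ → UnitSphere d) (t : ℕ) (m : Fin fb.M) :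
    Q.action fb (coupledParams r a δ) x₁ v t m ∈ Q.X := by
  have hx := (H.feasible h v t).1
  rcases fb.query_eq δ (Q.iterate fb (coupledParams r a δ) x₁ v t).1 (v t) m with e | e
  · change fb.query δ _ _ m ∈ Q.X
    exact e ▸ h.add_smul_mem H.δ_pos.le H.δ_le hx (norm_unitSphere _)
  · change fb.query δ _ _ m ∈ Q.X
    exact e ▸ h.sub_smul_mem H.δ_pos.le H.δ_le hx (norm_unitSphere _)

theorem norm_action_sub (H : Q.RunBounds fb η r a δ B x₁ z)
    (v : ℕ → UnitSphere d) (t : ℕ) (m : Fin fb.M) :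
    ‖Q.action fb (coupledParams r a δ) x₁ v t m - (Q.iterate fb (coupledParams r a δ) x₁ v t).1‖
      = δ := by
  have hδ := H.δ_pos
  rcases fb.query_eq δ (Q.iterate fb (coupledParams r a δ) x₁ v t).1 (v t) m with e | e
  · change ‖fb.query δ _ _ m - _‖ = δ
    rw [e, add_sub_cancel_left, norm_smul, norm_unitSphere, mul_one, Real.norm_eq_abs,
      abs_of_pos hδ]
  · change ‖fb.query δ _ _ m - _‖ = δ
    rw [e, sub_sub_cancel_left, norm_neg, norm_smul, norm_unitSphere, mul_one, Real.norm_eq_abs,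
      abs_of_pos hδ]

theorem integrable_f_action (hd : 0 < d) (h : Q.Regular F G η r R)
    (H : Q.RunBounds fb η r a δ B x₁ z) (t : ℕ) (m : Fin fb.M) :
    Integrable (fun v => Q.f t (Q.action fb (coupledParams r a δ) x₁ v t m)) (sphereSeq d) := by
  have := isProbabilityMeasure_sphereSeq hd
  refine Integrable.of_bound (((continuous_of_convexOn_univ (h.convex_f t)).measurable.comp
    (h.measurable_action fb _ x₁ t m)).aestronglyMeasurable) F (ae_of_all _ fun v => ?_)
  exact h.bound_f t _ (H.action_mem h v t m)

theorem integral_f_action_le (hd : 0 < d) (h : Q.Regular F G η r R)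
    (H : Q.RunBounds fb η r a δ B x₁ z) (t : ℕ) (m : Fin fb.M) :
    ∫ v, Q.f t (Q.action fb (coupledParams r a δ) x₁ v t m) ∂sphereSeq d ≤
      ∫ v, Q.f t (Q.iterate fb (coupledParams r a δ) x₁ v t).1 ∂sphereSeq d + G * δ := by
  have := isProbabilityMeasure_sphereSeq hd
  have i1 := H.integrable_f hd h t
  have h1 := integral_mono (H.integrable_f_action hd h t m) (i1.add (integrable_const (G * δ)))
    (fun v => by
      have := h.f_sub_le t (H.action_mem h v t m) (Q.iterate fb (coupledParams r a δ) x₁ v t).1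
      rw [H.norm_action_sub] at this
      simp only [Pi.add_apply]
      linarith)
  refine h1.trans (le_of_eq ?_)
  have e := integral_add i1 (integrable_const (G * δ))
  simpa only [Pi.add_apply, integral_const, probReal_univ, one_smul] using e

/-- The regret bound for a fixed horizon. -/
theorem regret_le (hd : 0 < d) (h : Q.Regular F G η r R) (H : Q.RunBounds fb η r a δ B x₁ z)
    {xs : ℕ → Vec d} (hxs : Q.IsSlotMinimizer xs) (T : ℕ) :
    Q.regret fb (coupledParams r a δ) x₁ (sphereSeq d) (fun t v => v t) xs T ≤
      T * (3 * δ * G + G * (δ / r) * R + a * stepConst N G η R B)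
      + (6 * R ^ 2 + 2 * R * variation xs T) / a
      + G * (δ / r) * R *
        ((2 * R ^ 2 / a + T * (2 * F + 2 * δ * G + a * stepConst N G η R B)) / η) := by
  have hr := h.r_pos
  have hR := h.R_pos
  have hG := h.G_nonneg
  have hδ := H.δ_pos
  have ha := H.a_pos
  have hδr := H.δ_le
  have hγ : 0 ≤ δ / r := by positivity
  have hM : (0 : ℝ) < fb.M := by exact_mod_cast fb.M_pos
  have h1 : 1 / (fb.M : ℝ) * ∑ t ∈ Finset.range T, ∑ m,
      ∫ v, Q.f t (Q.action fb (coupledParams r a δ) x₁ v t m) ∂sphereSeq d ≤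
      ∑ t ∈ Finset.range T,
        (∫ v, Q.f t (Q.iterate fb (coupledParams r a δ) x₁ v t).1 ∂sphereSeq d + G * δ) := by
    rw [Finset.mul_sum]
    refine Finset.sum_le_sum fun t _ => ?_
    have := Finset.sum_le_sum fun m (_ : m ∈ Finset.univ) => H.integral_f_action_le hd h t m
    rw [Finset.sum_const, Finset.card_univ, Fintype.card_fin, nsmul_eq_mul] at this
    calc _ ≤ 1 / (fb.M : ℝ) * (fb.M * (∫ v, Q.f t (Q.iterate fb (coupledParams r a δ) x₁ v t).1
          ∂sphereSeq d + G * δ)) := by gcongr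
      _ = _ := by field_simp
  have h2 := H.sum_integral_f_le hd h hxs T
  have h3 : ∑ t ∈ Finset.range T, Q.f t ((1 - δ / r) • xs t) ≤
      ∑ t ∈ Finset.range T, (Q.f t (xs t) + G * (δ / r) * R) := by
    refine Finset.sum_le_sum fun t _ => ?_
    have e1 := h.f_sub_le t (H.shrunken_subset h
      (Set.smul_mem_smul_set (a := 1 - δ / r) (hxs t).1.1)) (xs t)
    have e2 : ‖(1 - δ / r) • xs t - xs t‖ = δ / r * ‖xs t‖ := by
      have : (1 - δ / r) • xs t - xs t = -((δ / r) • xs t) := by module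
      rw [this, norm_neg, norm_smul, Real.norm_eq_abs, abs_of_nonneg hγ]
    rw [e2] at e1
    have e3 : G * (δ / r * ‖xs t‖) ≤ G * (δ / r * R) := by
      gcongr; exact h.norm_le (hxs t).1.1
    linarith
  -- The constant `6 * R ^ 2` consists of `2 * R ^ 2` for the initial potential and `2 * R * (2 *
  -- R)` for the extra increment.
  have h4 : (2 * R ^ 2 + 2 * R * ∑ t ∈ Finset.range T, ‖xs (t + 1) - xs t‖) / a ≤
      (6 * R ^ 2 + 2 * R * variation xs T) / a := by
    refine div_le_div_of_nonneg_right ?_ ha.le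
    have := mul_le_mul_of_nonneg_left (sum_range_le_variation h hxs T) (by positivity : 0 ≤ 2 * R)
    linarith
  have h5 : G * (δ / r) * R * ∑ t ∈ Finset.range T,
        ∫ v, ∑ n, (Q.iterate fb (coupledParams r a δ) x₁ v t).2 n ∂sphereSeq d ≤
      G * (δ / r) * R *
        ((2 * R ^ 2 / a + T * (2 * F + 2 * δ * G + a * stepConst N G η R B)) / η) := by
    gcongr
    exact H.sum_integral_dual_le hd h T
  simp only [Finset.sum_add_distrib, Finset.sum_const, Finset.card_range, nsmul_eq_mul] at h1 h3
  unfold regret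
  linarith

end RunBounds

end OnlineProblem

/-! ### Elementary bounds relating steps, dual sums and the potential -/

theorem norm_le_of_forall_abs_le {N : ℕ} {y : Vec N} {b : ℝ} (hb : ∀ n, |y n| ≤ b) :
    ‖y‖ ≤ N * b := by
  have h1 : y = ∑ n, EuclideanSpace.single n (y n) := by
    ext m
    simp
  rw [h1]
  refine (norm_sum_le _ _).trans ?_
  simp only [PiLp.norm_single, Real.norm_eq_abs]
  refine (Finset.sum_le_sum fun n _ => hb n).trans ?_
  simp

theorem norm_proj_sub_le {d : ℕ} {K : Set (Vec d)} (hne : K.Nonempty) (hcl : IsClosed K)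
    (hc : Convex ℝ K) {x : Vec d} (hx : x ∈ K) (w : Vec d) : ‖proj K (x - w) - x‖ ≤ ‖w‖ := by
  have h := norm_sub_proj_sq_le hne hcl hc x w hx
  rw [sub_self, norm_zero, inner_zero_right, norm_sub_rev x] at h
  have h1 := abs_real_inner_le_norm w (proj K (x - w) - x)
  have h2 := neg_abs_le (inner ℝ w (proj K (x - w) - x))
  by_contra! h3
  nlinarith [norm_nonneg w, norm_nonneg (proj K (x - w) - x)]

namespace OnlineProblem

variable {d N : ℕ} {Q : OnlineProblem d N} {F G η r R : ℝ}

theorem sum_dual_le_of_potential_le {y : Vec d} {s : Vec d × Vec N} {c : ℝ}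
    (hs : potential y s ≤ c) : ∑ n, s.2 n ≤ N * (2 * c + 1) := by
  have h (n : Fin N) : s.2 n ≤ 2 * c + 1 := by
    have h1 := (le_abs_self _).trans (PiLp.norm_apply_le s.2 n)
    unfold potential at hs
    nlinarith [sq_nonneg ‖y - s.1‖, sq_nonneg (‖s.2‖ - 1)]
  exact (Finset.sum_le_sum fun n _ => h n).trans (le_of_eq (by simp; ring))

theorem potential_le_of_sum_dual_le {y : Vec d} {s : Vec d × Vec N} {L D : ℝ}
    (hs : ∀ n, 0 ≤ s.2 n) (hL : ∑ n, s.2 n ≤ L) (hD : ‖y - s.1‖ ≤ 2 * D) :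
    potential y s ≤ L ^ 2 / 2 + 2 * D ^ 2 := by
  have h1 : ‖s.2‖ ^ 2 ≤ L ^ 2 := by
    rw [EuclideanSpace.norm_sq_eq]
    simp only [Real.norm_eq_abs, sq_abs]
    refine (Finset.sum_sq_le_sq_sum_of_nonneg fun n _ => hs n).trans ?_
    exact pow_le_pow_left₀ (Finset.sum_nonneg fun n _ => hs n) hL 2
  have h2 := pow_le_pow_left₀ (norm_nonneg _) hD 2
  unfold potential
  linarith

namespace RunBounds

variable {fb : Feedback} {a δ B : ℝ} {x₁ z : Vec d}

/-! ### The fit along a path -/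

theorem norm_step_le (h : Q.Regular F G η r R) (H : Q.RunBounds fb η r a δ B x₁ z)
    (v : ℕ → UnitSphere d) (t : ℕ) :
    ‖(Q.iterate fb (coupledParams r a δ) x₁ v (t + 1)).1 -
      (Q.iterate fb (coupledParams r a δ) x₁ v t).1‖ ≤
      a * (B + G * ∑ n, (Q.iterate fb (coupledParams r a δ) x₁ v t).2 n) := by
  obtain ⟨h1, h2⟩ := H.feasible h v t
  have hX := H.iterate_mem h v t
  set s := Q.iterate fb (coupledParams r a δ) x₁ v t
  have h3 := norm_proj_sub_le (h.nonempty_smul _) (h.closed_smul _) (h.convex_smul _) h1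
    (a • Q.lagrangianGradEst fb δ t s.1 s.2 (v t))
  refine h3.trans ?_
  rw [norm_smul, Real.norm_eq_abs, abs_of_pos H.a_pos]
  refine mul_le_mul_of_nonneg_left ?_ H.a_pos.le
  refine (norm_add_le _ _).trans (add_le_add (H.norm_gradEst_le t _ h1 _) ?_)
  refine (norm_sum_le _ _).trans ?_
  rw [Finset.mul_sum]
  refine Finset.sum_le_sum fun n _ => ?_
  rw [norm_smul, Real.norm_eq_abs, abs_of_nonneg (h2 n), mul_comm]
  exact mul_le_mul_of_nonneg_right (h.grad_g t n _ hX) (h2 n)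

theorem avg_action_le {p : BanSaPParams}
    (v : ℕ → UnitSphere d) (t : ℕ) (n : Fin N) {b : ℝ}
    (hb : ∀ m, Q.g t (Q.action fb p x₁ v t m) n ≤ b) :
    1 / (fb.M : ℝ) * ∑ m, Q.g t (Q.action fb p x₁ v t m) n ≤ b := by
  have hM : (0 : ℝ) < fb.M := by exact_mod_cast fb.M_pos
  have := Finset.sum_le_sum fun m (_ : m ∈ Finset.univ) => hb m
  rw [Finset.sum_const, Finset.card_univ, Fintype.card_fin, nsmul_eq_mul] at this
  calc _ ≤ 1 / (fb.M : ℝ) * (fb.M * b) := by gcongr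
    _ = _ := by field_simp

theorem fit_le_of_forall_le {p : BanSaPParams} {v : ℕ → UnitSphere d} {T : ℕ} {b : ℝ} (hb : 0 ≤ b)
    (h : ∀ n, ∑ t ∈ Finset.range T,
      1 / (fb.M : ℝ) * ∑ m, Q.g t (Q.action fb p x₁ v t m) n ≤ b) :
    Q.fit fb p x₁ v T ≤ N * b := by
  unfold fit
  refine norm_le_of_forall_abs_le fun n => ?_
  simp only
  rw [abs_of_nonneg (le_max_right _ _), Finset.mul_sum]
  exact max_le (h n) hb

/-- Linear in `T` and valid on every path, this is used for integrability and on the exceptional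
event. -/
theorem fit_le_crude (h : Q.Regular F G η r R) (H : Q.RunBounds fb η r a δ B x₁ z)
    (v : ℕ → UnitSphere d) (T : ℕ) :
    Q.fit fb (coupledParams r a δ) x₁ v T ≤ N * (T * (2 * R * G)) := by
  have hR := h.R_pos
  have hG := h.G_nonneg
  refine fit_le_of_forall_le (by positivity) fun n => ?_
  have : ∀ t ∈ Finset.range T, 1 / (fb.M : ℝ) *
      ∑ m, Q.g t (Q.action fb (coupledParams r a δ) x₁ v t m) n ≤ 2 * R * G := fun t _ =>
    avg_action_le v t n fun m => by
      have := h.g_le t n (H.action_mem h v t m)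
      linarith [h.eta_pos]
  refine (Finset.sum_le_sum this).trans ?_
  simp

/-- The fit is controlled by the dual iterates. -/
theorem fit_le (h : Q.Regular F G η r R) (H : Q.RunBounds fb η r a δ B x₁ z)
    (v : ℕ → UnitSphere d) (T : ℕ) {Λ : ℝ} (hB : 0 ≤ B)
    (hΛ : ∀ t ≤ T, ∑ n, (Q.iterate fb (coupledParams r a δ) x₁ v t).2 n ≤ Λ) :
    Q.fit fb (coupledParams r a δ) x₁ v T ≤
      N * (Λ / a + T * (G * (a * (B + G * Λ))) + T * (G * δ)) := by
  have hG := h.G_nonneg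
  have ha := H.a_pos
  have hδ := H.δ_pos
  have hΛ0 : 0 ≤ Λ := (Finset.sum_nonneg fun n _ => (H.feasible h v 0).2 n).trans
    (hΛ 0 (Nat.zero_le _))
  refine fit_le_of_forall_le (by positivity) fun n => ?_
  -- The dual update is at least its argument before the positive part. Read backwards, it bounds
  -- the constraint at the iterate by a dual increment over `a` plus `G` times the primal step; the
  -- increments telescope from `0`.
  have key : ∀ S ≤ T, ∑ t ∈ Finset.range S, 1 / (fb.M : ℝ) *
      ∑ m, Q.g t (Q.action fb (coupledParams r a δ) x₁ v t m) n ≤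
      (Q.iterate fb (coupledParams r a δ) x₁ v S).2 n / a +
        S * (G * (a * (B + G * Λ))) + S * (G * δ) := by
    intro S hS
    induction S with
    | zero => simp [iterate]
    | succ S ih =>
      have ih := ih (by lia)
      have h1 := avg_action_le v S n (b := Q.g S (Q.iterate fb (coupledParams r a δ)
        x₁ v S).1 n + G * δ) fun m => by
          have := h.g_sub_le S n (H.action_mem h v S m)
            (Q.iterate fb (coupledParams r a δ) x₁ v S).1
          rw [H.norm_action_sub] at this
          linarith
      have h2 := h.abs_inner_grad_g_le S n (H.iterate_mem h v S)
        ((Q.iterate fb (coupledParams r a δ) x₁ v (S + 1)).1 -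
          (Q.iterate fb (coupledParams r a δ) x₁ v S).1)
      have h3 : G * ‖(Q.iterate fb (coupledParams r a δ) x₁ v (S + 1)).1 -
          (Q.iterate fb (coupledParams r a δ) x₁ v S).1‖ ≤ G * (a * (B + G * Λ)) := by
        have e1 := hΛ S (by lia)
        have e2 := H.norm_step_le h v S
        calc _ ≤ _ := mul_le_mul_of_nonneg_left e2 hG
          _ ≤ _ := by gcongr
      have h4 : (Q.iterate fb (coupledParams r a δ) x₁ v S).2 n +
          a * (Q.g S (Q.iterate fb (coupledParams r a δ) x₁ v S).1 n +
          inner ℝ (∇ (fun y => Q.g S y n) (Q.iterate fb (coupledParams r a δ) x₁ v S).1)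
            ((Q.iterate fb (coupledParams r a δ) x₁ v (S + 1)).1 -
              (Q.iterate fb (coupledParams r a δ) x₁ v S).1)) ≤
          (Q.iterate fb (coupledParams r a δ) x₁ v (S + 1)).2 n := le_max_left _ _
      have h5 : Q.g S (Q.iterate fb (coupledParams r a δ) x₁ v S).1 n ≤
          (Q.iterate fb (coupledParams r a δ) x₁ v (S + 1)).2 n / a -
          (Q.iterate fb (coupledParams r a δ) x₁ v S).2 n / a + G * (a * (B + G * Λ)) := by
        rw [← sub_div]
        have e1 : Q.g S (Q.iterate fb (coupledParams r a δ) x₁ v S).1 n +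
          inner ℝ (∇ (fun y => Q.g S y n) (Q.iterate fb (coupledParams r a δ) x₁ v S).1)
            ((Q.iterate fb (coupledParams r a δ) x₁ v (S + 1)).1 -
              (Q.iterate fb (coupledParams r a δ) x₁ v S).1) ≤
          ((Q.iterate fb (coupledParams r a δ) x₁ v (S + 1)).2 n -
          (Q.iterate fb (coupledParams r a δ) x₁ v S).2 n) / a := by
          rw [le_div_iff₀ ha]; linarith
        have e2 := (abs_le.1 h2).1
        linarith
      rw [Finset.sum_range_succ]
      push_cast
      linarith
  refine (key T le_rfl).trans ?_
  gcongr
  exact (Finset.single_le_sum (fun n _ => (H.feasible h v T).2 n) (Finset.mem_univ n)).trans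
    (hΛ T le_rfl)

/-! ### Bounds for the dual iterates -/

/-- A deterministic bound, for gradient estimates bounded independently of the perturbation. -/
theorem potential_iterate_le_const (hd : 0 < d) (h : Q.Regular F G η r R)
    (H : Q.RunBounds fb η r a δ B x₁ z) {L : ℝ}
    (h1 : 2 * R * B + a * stepConst N G η R B ≤ η * L)
    (h2 : a * (2 * R * B) + a ^ 2 * stepConst N G η R B ≤ 1)
    (v : ℕ → UnitSphere d) (t : ℕ) :
    potential z (Q.iterate fb (coupledParams r a δ) x₁ v t) ≤ L ^ 2 / 2 + 2 * R ^ 2 + 1 := by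
  have hzX := H.shrunken_subset h H.slater_mem
  induction t with
  | zero =>
    have := H.potential_init_le h hzX v
    linarith [sq_nonneg L]
  | succ t ih =>
    have hf := H.feasible h v t
    rw [iterate_succ]
    -- If the multipliers sum to at most `L`, the potential is at most `L ^ 2 / 2 + 2 * R ^ 2` and
    -- one step adds at most `1`. Otherwise the Slater drift outweighs all error terms and the
    -- potential does not increase.
    rcases le_total (∑ n, (Q.iterate fb (coupledParams r a δ) x₁ v t).2 n) L with hl | hl
    · have e1 := H.potential_update_le_add hd h t hf (v t)
      have e2 := potential_le_of_sum_dual_le hf.2 hl (h.norm_sub_le hzX (H.iterate_mem h v t))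
      linarith
    · have e1 := H.potential_slater_update_le h t hf (v t)
      have e2 := mul_le_mul_of_nonneg_left ((le_abs_self _).trans
        (H.abs_inner_gradEst_le hd h t hf.1 H.slater_mem (v t))) H.a_pos.le
      have e3 := mul_le_mul_of_nonneg_left h1 H.a_pos.le
      have e4 := mul_le_mul_of_nonneg_left hl (mul_nonneg H.a_pos.le h.eta_pos.le)
      linarith

/-- The mean of the inner product is bounded independently of the worst-case size `Ξ`. That size
enters only through the second-order term, which a small `c` keeps bounded. -/
theorem integral_exp_inner_le (hd : 0 < d) (h : Q.Regular F G η r R)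
    (H : Q.RunBounds fb η r a δ B x₁ z) {c Ξ : ℝ} (hc : 0 ≤ c) (hΞ : 2 * R * B ≤ Ξ)
    (hcΞ : c * Ξ ≤ 1) (t : ℕ) {x : Vec d} (hx : x ∈ (1 - δ / r) • Q.X) :
    ∫ v, Real.exp (c * inner ℝ (fb.gradEst (Q.f t) δ x v) (z - x)) ∂uniformSphere d ≤
      Real.exp (c * (2 * F + 2 * δ * G + c * Ξ ^ 2)) := by
  have := isProbabilityMeasure_uniformSphere hd
  have hcont : Continuous fun v : UnitSphere d => inner ℝ (fb.gradEst (Q.f t) δ x v) (z - x) :=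
    ((fb.continuous_gradEst (continuous_of_convexOn_univ (h.convex_f t)) δ).comp
      (Continuous.prodMk_right x)).inner continuous_const
  have hb (v : UnitSphere d) : |inner ℝ (fb.gradEst (Q.f t) δ x v) (z - x)| ≤ Ξ :=
    (H.abs_inner_gradEst_le hd h t hx H.slater_mem v).trans hΞ
  set ξ : UnitSphere d → ℝ := fun v => inner ℝ (fb.gradEst (Q.f t) δ x v) (z - x) with hξ
  -- This is `exp x ≤ 1 + x + x ^ 2` for `|x| ≤ 1`.
  have hpt (v : UnitSphere d) : Real.exp (c * ξ v) ≤ 1 + c ^ 2 * Ξ ^ 2 + c * ξ v := by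
    have e1 : |c * ξ v| ≤ c * Ξ := by
      rw [abs_mul, abs_of_nonneg hc]
      exact mul_le_mul_of_nonneg_left (hb v) hc
    have e2 := (abs_le.1 (Real.abs_exp_sub_one_sub_id_le (e1.trans hcΞ))).2
    have e3 : (c * ξ v) ^ 2 ≤ (c * Ξ) ^ 2 := sq_le_sq' (abs_le.1 e1).1 (abs_le.1 e1).2
    linarith [mul_pow c Ξ 2]
  have hi : Integrable ξ (uniformSphere d) := integrable_sphere hd hcont
  have h1 : ∫ v, Real.exp (c * ξ v) ∂uniformSphere d ≤
      ∫ v, (1 + c ^ 2 * Ξ ^ 2 + c * ξ v) ∂uniformSphere d :=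
    integral_mono (integrable_sphere hd (by fun_prop))
      ((integrable_const _).add (hi.const_mul c)) hpt
  rw [integral_add (integrable_const _) (hi.const_mul c), integral_const_mul] at h1
  simp only [integral_const, probReal_univ, one_smul] at h1
  have h2 : ∫ v, ξ v ∂uniformSphere d ≤ 2 * F + 2 * δ * G := by
    have e1 := h.integral_gradEst_le hd fb H.δ_pos H.δ_le t hx H.slater_mem
    have e2 := abs_le.1 (h.bound_f t x (H.shrunken_subset h hx))
    have e3 := abs_le.1 (h.bound_f t z (H.shrunken_subset h H.slater_mem))
    simp only [hξ]
    linarith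
  have h3 := mul_le_mul_of_nonneg_left h2 hc
  have h4 := Real.add_one_le_exp (c * (2 * F + 2 * δ * G + c * Ξ ^ 2))
  linarith

theorem integrable_exp_potential (hd : 0 < d) (h : Q.Regular F G η r R)
    (H : Q.RunBounds fb η r a δ B x₁ z) {θ : ℝ} (hθ : 0 ≤ θ) (t : ℕ) :
    Integrable (fun v => Real.exp (θ * potential z (Q.iterate fb (coupledParams r a δ) x₁ v t)))
      (sphereSeq d) := by
  have := isProbabilityMeasure_sphereSeq hd
  have hm : Measurable fun v =>
      Real.exp (θ * potential z (Q.iterate fb (coupledParams r a δ) x₁ v t)) :=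
    (((continuous_potential z).measurable.comp (h.measurable_iterate fb _ x₁ t)).const_mul θ).exp
  refine Integrable.of_bound hm.aestronglyMeasurable (Real.exp (θ * (2 * R ^ 2 + t *
    (a * (2 * R * B) + a ^ 2 * stepConst N G η R B)))) (ae_of_all _ fun v => ?_)
  rw [Real.norm_eq_abs, abs_of_pos (Real.exp_pos _)]
  gcongr
  exact H.potential_iterate_le hd h v t

/-- Exponential moments of the potential. -/
theorem integral_exp_potential_le (hd : 0 < d) (h : Q.Regular F G η r R)
    (H : Q.RunBounds fb η r a δ B x₁ z) {θ Ξ L : ℝ} (hθ : 0 ≤ θ) (hΞ : 2 * R * B ≤ Ξ)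
    (hθΞ : θ * a * Ξ ≤ 1)
    (h1 : 2 * F + 2 * δ * G + θ * a * Ξ ^ 2 + a * stepConst N G η R B ≤ η * L)
    (h2 : a * Ξ + a ^ 2 * stepConst N G η R B ≤ 1) (t : ℕ) :
    ∫ v, Real.exp (θ * potential z (Q.iterate fb (coupledParams r a δ) x₁ v t)) ∂sphereSeq d ≤
      (t + 1) * Real.exp (θ * (L ^ 2 / 2 + 2 * R ^ 2 + 1)) := by
  have := isProbabilityMeasure_sphereSeq hd
  have hzX := H.shrunken_subset h H.slater_mem
  have ha := H.a_pos
  set K := stepConst N G η R B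
  set c₀ := L ^ 2 / 2 + 2 * R ^ 2 with hc₀
  have hint := H.integrable_exp_potential hd h hθ
  induction t with
  | zero =>
    have := integral_mono (hint 0) (integrable_const (Real.exp (θ * (c₀ + 1)))) (fun v => by
      simp only
      gcongr
      have := H.potential_init_le h hzX v
      linarith [sq_nonneg L])
    simpa using this
  | succ t ih =>
    -- This dominates the exponential of the next potential when the multipliers sum to at least
    -- `L`. By `h1`, averaging over the current direction makes the last two factors together at
    -- most `1`.
    set φ : (Vec d × Vec N) × UnitSphere d → ℝ := fun q => Real.exp (θ * potential z q.1) *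
      (Real.exp ((θ * a) * inner ℝ (fb.gradEst (Q.f t) δ q.1.1 q.2) (z - q.1.1)) *
        Real.exp (-((θ * a) * (η * L - a * K)))) with hφ
    have hφm : Measurable φ := by
      refine Measurable.mul ?_ (Measurable.mul_const ?_ _)
      · exact (((continuous_potential z).measurable.comp measurable_fst).const_mul θ).exp
      · exact ((measurable_inner_gradEst h fb δ t z).const_mul _).exp
    have hφint : Integrable (fun v => φ (Q.iterate fb (coupledParams r a δ) x₁ v t, v t))
        (sphereSeq d) := by
      refine Integrable.of_bound (hφm.comp ((h.measurable_iterate fb _ x₁ t).prodMk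
        (measurable_pi_apply t))).aestronglyMeasurable
        (Real.exp (θ * (2 * R ^ 2 + t * (a * (2 * R * B) + a ^ 2 * K))) * (Real.exp 1 *
          Real.exp (-((θ * a) * (η * L - a * K))))) (ae_of_all _ fun v => ?_)
      rw [Real.norm_eq_abs, abs_of_nonneg (by positivity)]
      simp only [hφ]
      have e1 : (θ * a) * inner ℝ (fb.gradEst (Q.f t) δ
          (Q.iterate fb (coupledParams r a δ) x₁ v t).1 (v t))
          (z - (Q.iterate fb (coupledParams r a δ) x₁ v t).1) ≤ 1 :=
        (mul_le_mul_of_nonneg_left ((le_abs_self _).trans ((H.abs_inner_gradEst_le hd h t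
          (H.feasible h v t).1 H.slater_mem (v t)).trans hΞ)) (by positivity)).trans hθΞ
      have e2 := H.potential_iterate_le hd h v t
      gcongr
    have hstep : ∫ v, φ (Q.iterate fb (coupledParams r a δ) x₁ v t, v t) ∂sphereSeq d ≤
        ∫ v, Real.exp (θ * potential z (Q.iterate fb (coupledParams r a δ) x₁ v t))
          ∂sphereSeq d := by
      refine h.integral_iterate_le hd fb (coupledParams r a δ) H.init t hφm hφint
        (ψ := fun s => Real.exp (θ * potential z s)) (fun s hs => ?_) (hint t)
      simp only [hφ]
      rw [integral_const_mul, integral_mul_const]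
      refine mul_le_of_le_one_right (Real.exp_pos _).le ?_
      have e1 := H.integral_exp_inner_le hd h (c := θ * a) (by positivity) hΞ hθΞ t hs.1
      calc _ ≤ Real.exp (θ * a * (2 * F + 2 * δ * G + θ * a * Ξ ^ 2)) *
            Real.exp (-((θ * a) * (η * L - a * K))) := by gcongr
        _ ≤ 1 := by
          rw [← Real.exp_add, Real.exp_le_one_iff]
          have := mul_le_mul_of_nonneg_left h1 (by positivity : 0 ≤ θ * a)
          linarith
    -- One of the two summands dominates in each of the cases of small and large multipliers. Each
    -- slot thus adds a fixed constant to the moment, whence the factor `t + 1`; no contraction is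
    -- needed.
    have hpt (v : ℕ → UnitSphere d) :
        Real.exp (θ * potential z (Q.iterate fb (coupledParams r a δ) x₁ v (t + 1))) ≤
        Real.exp (θ * (c₀ + 1)) + φ (Q.iterate fb (coupledParams r a δ) x₁ v t, v t) := by
      have hf := H.feasible h v t
      rw [iterate_succ]
      rcases le_total (∑ n, (Q.iterate fb (coupledParams r a δ) x₁ v t).2 n) L with hl | hl
      · have e1 := H.potential_update_le_add hd h t hf (v t)
        have e2 := potential_le_of_sum_dual_le hf.2 hl (h.norm_sub_le hzX (H.iterate_mem h v t))
        have e3 := mul_le_mul_of_nonneg_left hΞ ha.le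
        have e4 : Real.exp (θ * potential z (Q.update fb (coupledParams r a δ) t
            (Q.iterate fb (coupledParams r a δ) x₁ v t) (v t))) ≤ Real.exp (θ * (c₀ + 1)) := by
          gcongr
          linarith
        have e5 : 0 ≤ φ (Q.iterate fb (coupledParams r a δ) x₁ v t, v t) := by positivity
        linarith
      · have e1 := H.potential_slater_update_le h t hf (v t)
        have e4 := mul_le_mul_of_nonneg_left hl (mul_nonneg ha.le h.eta_pos.le)
        have e5 : Real.exp (θ * potential z (Q.update fb (coupledParams r a δ) t
            (Q.iterate fb (coupledParams r a δ) x₁ v t) (v t))) ≤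
            φ (Q.iterate fb (coupledParams r a δ) x₁ v t, v t) := by
          simp only [hφ]
          rw [← Real.exp_add, ← Real.exp_add]
          refine Real.exp_le_exp.2 ?_
          have := mul_le_mul_of_nonneg_left (e1.trans (by linarith :
            _ ≤ potential z (Q.iterate fb (coupledParams r a δ) x₁ v t)
              + (a * inner ℝ (fb.gradEst (Q.f t) δ (Q.iterate fb (coupledParams r a δ)
              x₁ v t).1 (v t)) (z - (Q.iterate fb (coupledParams r a δ) x₁ v t).1)
              - a * (η * L - a * K)))) hθ
          linarith
        linarith [Real.exp_pos (θ * (c₀ + 1))]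
    have hsum : Integrable (fun v => Real.exp (θ * (c₀ + 1)) +
        φ (Q.iterate fb (coupledParams r a δ) x₁ v t, v t)) (sphereSeq d) :=
      (integrable_const _).add hφint
    have e := integral_mono (hint (t + 1)) hsum hpt
    rw [integral_add (integrable_const _) hφint] at e
    simp only [integral_const, probReal_univ, one_smul] at e
    push_cast
    linarith

/-- With high probability the potential stays bounded over the whole horizon. -/
theorem measureReal_exists_potential_ge_le (hd : 0 < d) (h : Q.Regular F G η r R)
    (H : Q.RunBounds fb η r a δ B x₁ z) {θ Ξ L : ℝ} (hθ : 0 ≤ θ) (hΞ : 2 * R * B ≤ Ξ)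
    (hθΞ : θ * a * Ξ ≤ 1)
    (h1 : 2 * F + 2 * δ * G + θ * a * Ξ ^ 2 + a * stepConst N G η R B ≤ η * L)
    (h2 : a * Ξ + a ^ 2 * stepConst N G η R B ≤ 1) (T : ℕ) :
    (sphereSeq d).real {v | ∃ t ≤ T, L ^ 2 / 2 + 2 * R ^ 2 + 2 ≤
      potential z (Q.iterate fb (coupledParams r a δ) x₁ v t)} ≤
      (T + 1) ^ 2 * Real.exp (-θ) := by
  have := isProbabilityMeasure_sphereSeq hd
  have hone (t : ℕ) (ht : t ∈ Finset.range (T + 1)) :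
      (sphereSeq d).real {v | L ^ 2 / 2 + 2 * R ^ 2 + 2 ≤
        potential z (Q.iterate fb (coupledParams r a δ) x₁ v t)} ≤ (T + 1) * Real.exp (-θ) := by
    have e1 := H.integral_exp_potential_le hd h hθ hΞ hθΞ h1 h2 t
    have e2 := mul_meas_ge_le_integral_of_nonneg (μ := sphereSeq d)
      (f := fun v => Real.exp (θ * potential z (Q.iterate fb (coupledParams r a δ) x₁ v t)))
      (ae_of_all _ fun v => (Real.exp_pos _).le) (H.integrable_exp_potential hd h hθ t) (Real.exp (θ * (L ^ 2 / 2 + 2 * R ^ 2 + 2)))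
    have e3 : (sphereSeq d).real {v | L ^ 2 / 2 + 2 * R ^ 2 + 2 ≤
        potential z (Q.iterate fb (coupledParams r a δ) x₁ v t)} ≤
        (sphereSeq d).real {v | Real.exp (θ * (L ^ 2 / 2 + 2 * R ^ 2 + 2)) ≤
        Real.exp (θ * potential z (Q.iterate fb (coupledParams r a δ) x₁ v t))} := by
      refine measureReal_mono fun v hv => ?_
      exact Real.exp_le_exp.2 (mul_le_mul_of_nonneg_left hv hθ)
    -- Markov's inequality is applied one unit above the level of the moment bound, which leaves
    -- `exp (-θ)`.
    have e4 : Real.exp (θ * (L ^ 2 / 2 + 2 * R ^ 2 + 1)) =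
        Real.exp (θ * (L ^ 2 / 2 + 2 * R ^ 2 + 2)) * Real.exp (-θ) := by
      rw [← Real.exp_add]; congr 1; ring
    have e5 : (t : ℝ) + 1 ≤ T + 1 := by
      have : t ≤ T := by simpa [Nat.lt_succ_iff] using ht
      exact_mod_cast Nat.succ_le_succ this
    refine e3.trans (le_of_mul_le_mul_left ?_ (Real.exp_pos (θ * (L ^ 2 / 2 + 2 * R ^ 2 + 2))))
    refine (e2.trans e1).trans ?_
    rw [e4]
    have := mul_le_mul_of_nonneg_right e5 (by positivity :
      0 ≤ Real.exp (θ * (L ^ 2 / 2 + 2 * R ^ 2 + 2)) * Real.exp (-θ))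
    linarith
  have hset : {v | ∃ t ≤ T, L ^ 2 / 2 + 2 * R ^ 2 + 2 ≤
      potential z (Q.iterate fb (coupledParams r a δ) x₁ v t)} =
      ⋃ t ∈ Finset.range (T + 1), {v | L ^ 2 / 2 + 2 * R ^ 2 + 2 ≤
        potential z (Q.iterate fb (coupledParams r a δ) x₁ v t)} := by
    ext v
    simp
  rw [hset]
  refine (measureReal_biUnion_finset_le _ _).trans ((Finset.sum_le_sum hone).trans (le_of_eq ?_))
  simp
  ring

end RunBounds

end OnlineProblem

/-! ### Rates of the parameters at a fixed horizon -/

/-- Bounds for the parameters of a run over the horizon `T` that lead to regret and fit of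
order `T / y`. -/
structure Rates (T y a δ B K V c b κ β a₂ : ℝ) : Prop where
  one_le : 1 ≤ y
  le_T : y ≤ T
  δ_le : δ ≤ b / y
  K_le : a * K ≤ κ / y
  inv_le : 1 / a ≤ c * (T / y)
  V_le : V / a ≤ c * (T / y)
  B_le : a * B ≤ β / y
  a_le : a ≤ a₂ / y

/-- The constant in the regret bound. -/
noncomputable def regretConst (F G η r R c b κ : ℝ) : ℝ :=
  3 * b * G + G * (b / r) * R + κ + (6 * R ^ 2 + 2 * R) * c
    + G * (b / r) * R * ((2 * R ^ 2 * c + 2 * F + 2 * b * G + κ) / η)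

/-- The constant in the fit bound, when the dual iterates are bounded by `Λ`. -/
noncomputable def fitConst (N : ℕ) (G Λ c b β a₂ : ℝ) : ℝ :=
  N * (Λ * c + G * (β + G * Λ * a₂) + G * b)

namespace Rates

variable {T y a δ B K V c b κ β a₂ : ℝ}

theorem regret_bound_le (hr : Rates T y a δ B K V c b κ β a₂) {F G η r R : ℝ} (ha : 0 < a)
    (hδ : 0 < δ) (hK : 0 ≤ K) (hF : 0 ≤ F) (hG : 0 ≤ G) (hη : 0 < η) (hr0 : 0 < r) (hR : 0 < R) :
    T * (3 * δ * G + G * (δ / r) * R + a * K) + (6 * R ^ 2 + 2 * R * V) / a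
      + G * (δ / r) * R * ((2 * R ^ 2 / a + T * (2 * F + 2 * δ * G + a * K)) / η) ≤
    regretConst F G η r R c b κ * (T / y) := by
  obtain ⟨h1, h2, h3, h4, h5, h6, h7, h8⟩ := hr
  have hy : 0 < y := by linarith
  have hT : 0 < T := by linarith
  have hb : 0 < b := by
    have := hδ.trans_le h3
    rwa [div_pos_iff_of_pos_right hy] at this
  have hκ : 0 ≤ κ := by
    have : 0 * y ≤ κ := (le_div_iff₀ hy).1 ((by positivity : 0 ≤ a * K).trans h4)
    linarith
  have hc : 0 < c := by
    have : 0 < c * (T / y) := (by positivity : 0 < 1 / a).trans_le h5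
    exact (mul_pos_iff_of_pos_right (by positivity)).1 this
  have e1 : T * (3 * δ * G + G * (δ / r) * R + a * K) ≤
      (3 * b * G + G * (b / r) * R + κ) * (T / y) := by
    calc _ ≤ T * (3 * (b / y) * G + G * ((b / y) / r) * R + κ / y) := by gcongr
      _ = _ := by field_simp
  have e2 : (6 * R ^ 2 + 2 * R * V) / a ≤ (6 * R ^ 2 + 2 * R) * c * (T / y) := by
    calc (6 * R ^ 2 + 2 * R * V) / a = 6 * R ^ 2 * (1 / a) + 2 * R * (V / a) := by ring
      _ ≤ 6 * R ^ 2 * (c * (T / y)) + 2 * R * (c * (T / y)) := by gcongr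
      _ = _ := by ring
  have e3 : T / y ≤ T := div_le_self hT.le h1
  -- Order `T` suffices for the accumulated multipliers, since their prefactor `δ` already supplies
  -- `1 / y`.
  have e4 : 2 * R ^ 2 / a + T * (2 * F + 2 * δ * G + a * K) ≤
      (2 * R ^ 2 * c + 2 * F + 2 * b * G + κ) * T := by
    calc 2 * R ^ 2 / a + T * (2 * F + 2 * δ * G + a * K)
        = 2 * R ^ 2 * (1 / a) + T * (2 * F + 2 * δ * G + a * K) := by ring
      _ ≤ 2 * R ^ 2 * (c * T) + T * (2 * F + 2 * b * G + κ) := by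
        have : δ ≤ b := h3.trans (div_le_self hb.le h1)
        have : a * K ≤ κ := h4.trans (div_le_self hκ h1)
        have : 1 / a ≤ c * T := h5.trans (by gcongr)
        gcongr
      _ = _ := by ring
  have e5 : G * (δ / r) * R * ((2 * R ^ 2 / a + T * (2 * F + 2 * δ * G + a * K)) / η) ≤
      G * (b / r) * R * ((2 * R ^ 2 * c + 2 * F + 2 * b * G + κ) / η) * (T / y) := by
    calc _ ≤ G * ((b / y) / r) * R *
          (((2 * R ^ 2 * c + 2 * F + 2 * b * G + κ) * T) / η) := by gcongr
      _ = _ := by field_simp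
  unfold regretConst
  linarith

theorem fit_bound_le (hr : Rates T y a δ B K V c b κ β a₂) {N : ℕ} {G Λ : ℝ} (hG : 0 ≤ G)
    (hΛ : 0 ≤ Λ) :
    N * (Λ / a + T * (G * (a * (B + G * Λ))) + T * (G * δ)) ≤
      fitConst N G Λ c b β a₂ * (T / y) := by
  obtain ⟨h1, h2, h3, h4, h5, h6, h7, h8⟩ := hr
  have hy : 0 < y := by linarith
  have hT : 0 < T := by linarith
  calc N * (Λ / a + T * (G * (a * (B + G * Λ))) + T * (G * δ))
      = N * (Λ * (1 / a) + T * (G * (a * B + G * Λ * a)) + T * (G * δ)) := by ring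
    _ ≤ N * (Λ * (c * (T / y)) + T * (G * (β / y + G * Λ * (a₂ / y))) + T * (G * (b / y))) := by
      gcongr
    _ = _ := by unfold fitConst; field_simp

end Rates

/-- With `δ` of order `1 / s` and `a` of order `1 / s ^ 3`, gradient estimates of size `s` make `a *
B ^ 2` of order `1 / s`, as is `δ`. A variation of at most `T / s ^ 4`, divided by `a`, is of order
`T / s`. These choices balance the errors. -/
theorem rates_one {d N : ℕ} {F G η R T s a δ V a₁ a₂ b₁ b₂ : ℝ} (ha₁ : 0 < a₁) (hb₁ : 0 < b₁)
    (hF : 0 ≤ F) (hs : 1 ≤ s) (hsT : s ^ 4 ≤ T) (ha : a₁ / s ^ 3 ≤ a) (ha' : a ≤ a₂ / s ^ 3)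
    (hδ : b₁ / s ≤ δ) (hδ' : δ ≤ b₂ / s) (hV : V ≤ T / s ^ 4) :
    Rates T s a δ (d * F / δ) (OnlineProblem.stepConst N G η R (d * F / δ)) V (1 / a₁) b₂
      (a₂ * (((d * F / b₁) ^ 2 + N * (4 * R * G + η) ^ 2) / 2)) (a₂ * (d * F / b₁)) a₂ := by
  have hs0 : 0 < s := by linarith
  have hT : 0 < T := lt_of_lt_of_le (by positivity) hsT
  have ha0 : 0 < a := lt_of_lt_of_le (by positivity) ha
  have ha2 : 0 < a₂ := by
    have := ha0.trans_le ha'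
    rwa [div_pos_iff_of_pos_right (by positivity)] at this
  have hδ0 : 0 < δ := lt_of_lt_of_le (by positivity) hδ
  have hB : d * F / δ ≤ d * F / b₁ * s := by
    calc d * F / δ ≤ d * F / (b₁ / s) := by gcongr
      _ = _ := by field_simp
  have hB0 : 0 ≤ d * F / δ := by positivity
  have hinv : 1 / a ≤ s ^ 3 / a₁ := by
    calc 1 / a ≤ 1 / (a₁ / s ^ 3) := by gcongr
      _ = _ := by field_simp
  have hinv' : s ^ 3 / a₁ ≤ 1 / a₁ * (T / s) := by
    calc s ^ 3 / a₁ = 1 / a₁ * (s ^ 4 / s) := by field_simp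
      _ ≤ _ := by gcongr
  have hs12 : s ≤ s ^ 2 := le_self_pow₀ hs (by norm_num)
  have hs13 : s ≤ s ^ 3 := le_self_pow₀ hs (by norm_num)
  refine ⟨hs, (le_self_pow₀ hs (by norm_num)).trans hsT, hδ', ?_, hinv.trans hinv', ?_, ?_,
    ha'.trans (by gcongr)⟩
  · unfold OnlineProblem.stepConst
    have hH : (0 : ℝ) ≤ N * (4 * R * G + η) ^ 2 := by positivity
    generalize (N * (4 * R * G + η) ^ 2 : ℝ) = D at hH ⊢
    calc a * (((d * F / δ) ^ 2 + D) / 2)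
        ≤ a₂ / s ^ 3 * (((d * F / b₁ * s) ^ 2 + D * s ^ 2) / 2) := by
          gcongr
          exact le_mul_of_one_le_right hH (one_le_pow₀ hs)
      _ = _ := by field_simp
  · calc V / a = V * (1 / a) := by ring
      _ ≤ T / s ^ 4 * (1 / a) := by gcongr
      _ ≤ T / s ^ 4 * (s ^ 3 / a₁) := by gcongr
      _ = _ := by field_simp
  · calc a * (d * F / δ) ≤ a₂ / s ^ 3 * (d * F / b₁ * s) := by gcongr
      _ = a₂ * (d * F / b₁) / s ^ 2 := by field_simp
      _ ≤ _ := by gcongr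

/-- Here `B` is constant, so `a` of order `1 / q` balances `a * K` against `V / a` with `V ≤ T / q ^
2`, and `δ` needs no lower bound beyond positivity of the run. -/
theorem rates_two {d N : ℕ} {G η R T q a δ V a₁ a₂ b₂ : ℝ} (ha₁ : 0 < a₁)
    (hG : 0 ≤ G) (hq : 1 ≤ q) (hqT : q ^ 2 ≤ T) (ha : a₁ / q ≤ a) (ha' : a ≤ a₂ / q)
    (hδ' : δ ≤ b₂ / q) (hV : V ≤ T / q ^ 2) :
    Rates T q a δ (d * G) (OnlineProblem.stepConst N G η R (d * G)) V (1 / a₁) b₂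
      (a₂ * OnlineProblem.stepConst N G η R (d * G)) (a₂ * (d * G)) a₂ := by
  have hq0 : 0 < q := by linarith
  have hT : 0 < T := lt_of_lt_of_le (by positivity) hqT
  have ha0 : 0 < a := lt_of_lt_of_le (by positivity) ha
  have hinv : 1 / a ≤ q / a₁ := by
    calc 1 / a ≤ 1 / (a₁ / q) := by gcongr
      _ = _ := by field_simp
  have hinv' : q / a₁ ≤ 1 / a₁ * (T / q) := by
    calc q / a₁ = 1 / a₁ * (q ^ 2 / q) := by field_simp
      _ ≤ _ := by gcongr
  have hK := OnlineProblem.stepConst_nonneg N G η R (d * G)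
  refine ⟨hq, (le_self_pow₀ hq (by norm_num)).trans hqT, hδ', ?_, hinv.trans hinv', ?_, ?_, ha'⟩
  · rw [mul_div_right_comm]
    gcongr
  · calc V / a = V * (1 / a) := by ring
      _ ≤ T / q ^ 2 * (1 / a) := by gcongr
      _ ≤ T / q ^ 2 * (q / a₁) := by gcongr
      _ = _ := by field_simp
  · rw [mul_div_right_comm]
    gcongr

/-! ### Powers of the horizon -/

/-- Writing all powers of the horizon through `T ^ ((1 - ρ) / 4)` turns the remaining estimates into
algebra with integer exponents. -/
theorem rpow_horizon_one {T ρ : ℝ} (hT : 1 ≤ T) (hρ : ρ ∈ Set.Ico (0 : ℝ) 1) :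
    1 ≤ T ^ ((1 - ρ) / 4) ∧ (T ^ ((1 - ρ) / 4)) ^ 4 ≤ T ∧
    T ^ (3 * (ρ - 1) / 4) = 1 / (T ^ ((1 - ρ) / 4)) ^ 3 ∧
    T ^ ((ρ - 1) / 4) = 1 / T ^ ((1 - ρ) / 4) ∧
    T ^ ((ρ + 3) / 4) = T / T ^ ((1 - ρ) / 4) ∧ T ^ ρ = T / (T ^ ((1 - ρ) / 4)) ^ 4 := by
  obtain ⟨h0, h1⟩ := hρ
  have hT0 : 0 < T := by linarith
  have e3 : (T ^ ((1 - ρ) / 4)) ^ 3 = T ^ (3 * (1 - ρ) / 4) := by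
    rw [← Real.rpow_natCast, ← Real.rpow_mul hT0.le]; congr 1; push_cast; ring
  have e4 : (T ^ ((1 - ρ) / 4)) ^ 4 = T ^ (1 - ρ) := by
    rw [← Real.rpow_natCast, ← Real.rpow_mul hT0.le]; congr 1; push_cast; ring
  refine ⟨Real.one_le_rpow hT (by linarith), ?_, ?_, ?_, ?_, ?_⟩
  · rw [e4]
    calc T ^ (1 - ρ) ≤ T ^ (1 : ℝ) := Real.rpow_le_rpow_of_exponent_le hT (by linarith)
      _ = T := Real.rpow_one T
  · rw [e3, one_div, ← Real.rpow_neg hT0.le]; congr 1; ring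
  · rw [one_div, ← Real.rpow_neg hT0.le]; congr 1; ring
  · nth_rewrite 2 [← Real.rpow_one T]
    rw [← Real.rpow_sub hT0]; congr 1; ring
  · rw [e4]
    nth_rewrite 2 [← Real.rpow_one T]
    rw [← Real.rpow_sub hT0]; congr 1; ring

theorem rpow_horizon_two {T ρ : ℝ} (hT : 1 ≤ T) (hρ : ρ ∈ Set.Ico (0 : ℝ) 1) :
    1 ≤ T ^ ((1 - ρ) / 2) ∧ (T ^ ((1 - ρ) / 2)) ^ 2 ≤ T ∧
    T ^ ((ρ - 1) / 2) = 1 / T ^ ((1 - ρ) / 2) ∧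
    T ^ ((ρ + 1) / 2) = T / T ^ ((1 - ρ) / 2) ∧ T ^ ρ = T / (T ^ ((1 - ρ) / 2)) ^ 2 := by
  obtain ⟨h0, h1⟩ := hρ
  have hT0 : 0 < T := by linarith
  have e2 : (T ^ ((1 - ρ) / 2)) ^ 2 = T ^ (1 - ρ) := by
    rw [← Real.rpow_natCast, ← Real.rpow_mul hT0.le]; congr 1; push_cast; ring
  refine ⟨Real.one_le_rpow hT (by linarith), ?_, ?_, ?_, ?_⟩
  · rw [e2]
    calc T ^ (1 - ρ) ≤ T ^ (1 : ℝ) := Real.rpow_le_rpow_of_exponent_le hT (by linarith)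
      _ = T := Real.rpow_one T
  · rw [one_div, ← Real.rpow_neg hT0.le]; congr 1; ring
  · nth_rewrite 2 [← Real.rpow_one T]
    rw [← Real.rpow_sub hT0]; congr 1; ring
  · rw [e2]
    nth_rewrite 2 [← Real.rpow_one T]
    rw [← Real.rpow_sub hT0]; congr 1; ring

theorem tendsto_natCast_rpow {ε : ℝ} (hε : 0 < ε) :
    Tendsto (fun T : ℕ => (T : ℝ) ^ ε) atTop atTop :=
  (tendsto_rpow_atTop hε).comp tendsto_natCast_atTop_atTop

theorem eventually_div_rpow_le {ε c : ℝ} (hε : 0 < ε) (k : ℝ) (hc : 0 < c) :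
    ∀ᶠ T : ℕ in atTop, k / (T : ℝ) ^ ε ≤ c :=
  ((tendsto_natCast_rpow hε).const_div_atTop k).eventually_le_const hc

theorem eventually_sq_mul_exp_le {ε κ : ℝ} (hε : 0 < ε) (hκ : 0 < κ) :
    ∀ᶠ T : ℕ in atTop, ((T : ℝ) + 1) ^ 2 * Real.exp (-(κ * (T : ℝ) ^ ε)) ≤ 1 / (T : ℝ) ^ 2 := by
  -- The exponent yields `T ^ (-5)`, which leaves a summable `1 / T ^ 2` after `(T + 1) ^ 2 ≤ T ^ 3`
  -- is spent.
  have h := ((isLittleO_exp_neg_mul_rpow_atTop hκ (-(5 / ε))).comp_tendsto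
    (tendsto_natCast_rpow hε)).bound one_pos
  filter_upwards [h, eventually_ge_atTop 4] with T hT h4
  have h4' : (4 : ℝ) ≤ T := by exact_mod_cast h4
  have hT0 : (0 : ℝ) < T := by linarith
  simp only [Function.comp_apply, Real.norm_eq_abs, Real.abs_exp, one_mul, neg_mul] at hT
  rw [abs_of_pos (by positivity), ← Real.rpow_mul hT0.le] at hT
  have e1 : (T : ℝ) ^ (ε * -(5 / ε)) = 1 / (T : ℝ) ^ 5 := by
    have : ε * -(5 / ε) = -((5 : ℕ) : ℝ) := by push_cast; field_simp
    rw [this, Real.rpow_neg hT0.le, Real.rpow_natCast, one_div]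
  rw [e1] at hT
  calc ((T : ℝ) + 1) ^ 2 * Real.exp (-(κ * (T : ℝ) ^ ε))
      ≤ (T + 1) ^ 2 * (1 / (T : ℝ) ^ 5) := by gcongr
    _ ≤ (T : ℝ) ^ 3 * (1 / (T : ℝ) ^ 5) := by
      gcongr
      nlinarith [mul_nonneg (sub_nonneg.2 h4') (sq_nonneg (T : ℝ)), mul_pos hT0 hT0]
    _ = _ := by field_simp

/-! ### From sequences of directions to general probability spaces -/

theorem ProbabilityTheory.HasLaw.integrable_comp {Ω S : Type*} [MeasurableSpace Ω]
    [MeasurableSpace S] {P : Measure Ω} {ν : Measure S} {X : Ω → S} (hX : HasLaw X ν P)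
    {φ : S → ℝ} (hφ : Integrable φ ν) : Integrable (fun ω => φ (X ω)) P := by
  rw [← hX.map_eq] at hφ
  exact hφ.comp_aemeasurable hX.aemeasurable

namespace OnlineProblem

variable {d N : ℕ} {Q : OnlineProblem d N} {F G η r R : ℝ}

namespace RunBounds

variable {fb : Feedback} {a δ B : ℝ} {x₁ z : Vec d} {Ω : Type*} [MeasurableSpace Ω]
  {P : Measure Ω} {u : ℕ → Ω → UnitSphere d}

theorem regret_eq (hd : 0 < d) (h : Q.Regular F G η r R) (H : Q.RunBounds fb η r a δ B x₁ z)
    (hu : IsUniformIID P u) (xs : ℕ → Vec d) (T : ℕ) :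
    Q.regret fb (coupledParams r a δ) x₁ P u xs T =
      Q.regret fb (coupledParams r a δ) x₁ (sphereSeq d) (fun t v => v t) xs T := by
  unfold regret
  congr 2
  refine Finset.sum_congr rfl fun t _ => Finset.sum_congr rfl fun m _ => ?_
  exact hu.hasLaw.integral_comp (H.integrable_f_action hd h t m).aestronglyMeasurable

theorem regret_le_rate (hd : 0 < d) (h : Q.Regular F G η r R)
    (H : Q.RunBounds fb η r a δ B x₁ z) (hu : IsUniformIID P u) {xs : ℕ → Vec d}
    (hxs : Q.IsSlotMinimizer xs) (T : ℕ) {y c b κ β a₂ : ℝ}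
    (hr : Rates T y a δ B (stepConst N G η R B) (variation xs T) c b κ β a₂) :
    Q.regret fb (coupledParams r a δ) x₁ P u xs T ≤ regretConst F G η r R c b κ * (T / y) := by
  rw [H.regret_eq hd h hu]
  exact (H.regret_le hd h hxs T).trans (hr.regret_bound_le H.a_pos H.δ_pos
    (stepConst_nonneg _ _ _ _ _) h.F_nonneg h.G_nonneg h.eta_pos h.r_pos h.R_pos)

theorem integrable_f_action_comp (hd : 0 < d) (h : Q.Regular F G η r R)
    (H : Q.RunBounds fb η r a δ B x₁ z) (hu : IsUniformIID P u) (t : ℕ) (m : Fin fb.M) :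
    Integrable (fun ω => Q.f t (Q.action fb (coupledParams r a δ) x₁ (fun s => u s ω) t m)) P :=
  hu.hasLaw.integrable_comp (H.integrable_f_action hd h t m)

theorem fit_nonneg (p : BanSaPParams) (v : ℕ → UnitSphere d) (T : ℕ) :
    0 ≤ Q.fit fb p x₁ v T := norm_nonneg _

theorem integrable_fit (hd : 0 < d) (h : Q.Regular F G η r R)
    (H : Q.RunBounds fb η r a δ B x₁ z) (T : ℕ) :
    Integrable (fun v => Q.fit fb (coupledParams r a δ) x₁ v T) (sphereSeq d) := by
  have := isProbabilityMeasure_sphereSeq hd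
  refine Integrable.of_bound (h.measurable_fit fb _ x₁ T).aestronglyMeasurable
    (N * (T * (2 * R * G))) (ae_of_all _ fun v => ?_)
  rw [Real.norm_eq_abs, abs_of_nonneg (fit_nonneg _ _ _)]
  exact H.fit_le_crude h v T

theorem measurableSet_exists_potential_ge (h : Q.Regular F G η r R) (p : BanSaPParams) (c : ℝ)
    (T : ℕ) : MeasurableSet {v | ∃ t ≤ T, c ≤ potential z (Q.iterate fb p x₁ v t)} := by
  have hset : {v | ∃ t ≤ T, c ≤ potential z (Q.iterate fb p x₁ v t)} =
      ⋃ t ∈ Finset.range (T + 1), {v | c ≤ potential z (Q.iterate fb p x₁ v t)} := by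
    ext v
    simp
  rw [hset]
  exact Finset.measurableSet_biUnion _ fun t _ => measurableSet_le measurable_const
    ((continuous_potential z).measurable.comp (h.measurable_iterate fb p x₁ t))

theorem fit_le_rate (h : Q.Regular F G η r R) (H : Q.RunBounds fb η r a δ B x₁ z)
    (T : ℕ) {y V c b κ β a₂ C : ℝ} (hB : 0 ≤ B)
    (hr : Rates T y a δ B (stepConst N G η R B) V c b κ β a₂) (v : ℕ → UnitSphere d)
    (hv : ∀ t ≤ T, potential z (Q.iterate fb (coupledParams r a δ) x₁ v t) ≤ C) :
    Q.fit fb (coupledParams r a δ) x₁ v T ≤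
      fitConst N G (N * (2 * C + 1)) c b β a₂ * (T / y) := by
  have hC : 0 ≤ C := (potential_nonneg _ _).trans (hv 0 (Nat.zero_le _))
  exact (H.fit_le h v T hB fun t ht => sum_dual_le_of_potential_le (hv t ht)).trans
    (hr.fit_bound_le h.G_nonneg (by positivity))

/-- The fit obeys the rate off the exceptional event and the crude linear bound on it. -/
theorem integral_fit_le (hd : 0 < d) (h : Q.Regular F G η r R)
    (H : Q.RunBounds fb η r a δ B x₁ z) (T : ℕ) {y V c b κ β a₂ C p : ℝ}
    (hr : Rates T y a δ B (stepConst N G η R B) V c b κ β a₂) (hC : 0 ≤ C)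
    (hp : (sphereSeq d).real {v | ∃ t ≤ T, C ≤
      potential z (Q.iterate fb (coupledParams r a δ) x₁ v t)} ≤ p) :
    ∫ v, Q.fit fb (coupledParams r a δ) x₁ v T ∂sphereSeq d ≤
      fitConst N G (N * (2 * C + 1)) c b β a₂ * (T / y) + N * (T * (2 * R * G)) * p := by
  have := isProbabilityMeasure_sphereSeq hd
  have hR := h.R_pos
  have hG := h.G_nonneg
  set A : Set (ℕ → UnitSphere d) := {v | ∃ t ≤ T, C ≤
      potential z (Q.iterate fb (coupledParams r a δ) x₁ v t)} with hA
  have hAm : MeasurableSet A := measurableSet_exists_potential_ge h _ _ _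
  have hc0 : 0 ≤ fitConst N G (N * (2 * C + 1)) c b β a₂ * (T / y) := by
    refine le_trans ?_ (hr.fit_bound_le (N := N) hG (by positivity))
    have ha := H.a_pos
    have hδ := H.δ_pos
    have hB := H.B_nonneg hd
    positivity
  have hi : Integrable (A.indicator fun _ => (N * (T * (2 * R * G)) : ℝ)) (sphereSeq d) :=
    (integrable_const _).indicator hAm
  have h1 := integral_mono (H.integrable_fit hd h T)
    ((integrable_const (fitConst N G (N * (2 * C + 1)) c b β a₂ * (T / y))).add hi) (fun v => by
      simp only [Pi.add_apply]
      by_cases hv : v ∈ A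
      · rw [Set.indicator_of_mem hv]
        linarith [H.fit_le_crude h v T]
      · rw [Set.indicator_of_notMem hv, add_zero]
        refine H.fit_le_rate h T (H.B_nonneg hd) hr v fun t ht => ?_
        by_contra! hlt
        exact hv ⟨t, ht, hlt.le⟩)
  have e := integral_add
    (integrable_const (μ := sphereSeq d) (fitConst N G (N * (2 * C + 1)) c b β a₂ * (T / y))) hi
  rw [integral_indicator_const _ hAm] at e
  simp only [integral_const, probReal_univ, smul_eq_mul, one_mul] at e
  simp only [Pi.add_apply] at h1
  rw [e] at h1
  have h2 : (sphereSeq d).real A * (N * (T * (2 * R * G))) ≤ p * (N * (T * (2 * R * G))) := by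
    gcongr
  linarith

end RunBounds

end OnlineProblem

/-! ### Parameters for large horizons -/

namespace OnlineProblem

variable {d N : ℕ} {Q : OnlineProblem d N} {F G η r R : ℝ}

/-- The margin `γ₀` is fixed while `δ T / r` tends to `0`, so one Slater point lies in the shrunken
sets of all large horizons. -/
theorem Regular.exists_slater_mem (h : Q.Regular F G η r R) {δ : ℕ → ℝ}
    (hδ : ∀ᶠ T in atTop, 0 < δ T) (hlim : ∀ c > 0, ∀ᶠ T in atTop, δ T ≤ c) :
    ∃ z, (∀ t n, Q.g t z n ≤ -η) ∧
      ∀ᶠ T in atTop, δ T / r ≤ 1 ∧ z ∈ (1 - δ T / r) • Q.X := by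
  obtain ⟨γ, hγ, z, hz, hzg⟩ := h.slater
  refine ⟨z, hzg, ?_⟩
  have hr := h.r_pos
  filter_upwards [hδ, hlim (γ * r) (mul_pos hγ.1 hr)] with T h1 h2
  have h3 : δ T / r ≤ γ := (div_le_iff₀ hr).2 h2
  exact ⟨h3.trans hγ.2.le, h.smul_subset_smul (by linarith [hγ.2]) (by linarith) hz⟩

/-- The bound for the potential that holds with high probability under one-point feedback. -/
noncomputable def highProbBound (F G η R : ℝ) : ℝ :=
  ((2 * F + 2 * G + 2) / η) ^ 2 / 2 + 2 * R ^ 2 + 2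

theorem highProbBound_nonneg (F G η R : ℝ) : 0 ≤ highProbBound F G η R := by
  unfold highProbBound; positivity

/-- The little-o hypothesis permits the constant `1`, so the final `C` does not depend on the
comparator sequence. -/
theorem eventually_variation_le {xs : ℕ → Vec d} {ρ : ℝ}
    (hV : (fun T : ℕ => variation xs T) =o[atTop] (fun T : ℕ => (T : ℝ) ^ ρ)) :
    ∀ᶠ T : ℕ in atTop, variation xs T ≤ (T : ℝ) ^ ρ := by
  filter_upwards [hV.bound one_pos] with T hT
  rw [one_mul, Real.norm_eq_abs, Real.norm_eq_abs, abs_of_nonneg (by positivity :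
    (0 : ℝ) ≤ (T : ℝ) ^ ρ)] at hT
  exact (le_abs_self _).trans hT

/-- One-point feedback: for all large horizons the parameters have the required rates and the
potential is bounded with high probability. -/
theorem Regular.eventually_one (hd : 0 < d) (h : Q.Regular F G η r R) {ρ a₁ a₂ b₁ b₂ : ℝ}
    (hρ : ρ ∈ Set.Ico (0 : ℝ) 1) (ha₁ : 0 < a₁) (hb₁ : 0 < b₁) {xs : ℕ → Vec d}
    (hV : (fun T : ℕ => variation xs T) =o[atTop] (fun T : ℕ => (T : ℝ) ^ ρ))
    {α δ : ℕ → ℝ} {x₁ : ℕ → Vec d}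
    (hα : ∀ᶠ T : ℕ in atTop, a₁ * (T : ℝ) ^ (3 * (ρ - 1) / 4) ≤ α T ∧
      α T ≤ a₂ * (T : ℝ) ^ (3 * (ρ - 1) / 4))
    (hδ : ∀ᶠ T : ℕ in atTop, b₁ * (T : ℝ) ^ ((ρ - 1) / 4) ≤ δ T ∧
      δ T ≤ b₂ * (T : ℝ) ^ ((ρ - 1) / 4))
    (hx : ∀ᶠ T : ℕ in atTop, x₁ T ∈ (1 - δ T / r) • Q.X) :
    ∃ z, ∀ᶠ T : ℕ in atTop,
      Q.RunBounds Feedback.one η r (α T) (δ T) (d * F / δ T) (x₁ T) z ∧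
      Rates T ((T : ℝ) ^ ((1 - ρ) / 4)) (α T) (δ T) (d * F / δ T)
        (stepConst N G η R (d * F / δ T)) (variation xs T) (1 / a₁) b₂
        (a₂ * (((d * F / b₁) ^ 2 + N * (4 * R * G + η) ^ 2) / 2)) (a₂ * (d * F / b₁)) a₂ ∧
      (sphereSeq d).real {v | ∃ t ≤ T, highProbBound F G η R ≤ potential z
        (Q.iterate Feedback.one (coupledParams r (α T) (δ T)) (x₁ T) v t)} ≤ 1 / (T : ℝ) ^ 2 := by
  have hε : 0 < (1 - ρ) / 4 := by linarith [hρ.2]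
  have hF := h.F_nonneg
  have hG := h.G_nonneg
  have hR := h.R_pos
  have hη := h.eta_pos
  have hbounds : ∀ᶠ T : ℕ in atTop, 1 ≤ (T : ℝ) ^ ((1 - ρ) / 4) ∧
      ((T : ℝ) ^ ((1 - ρ) / 4)) ^ 4 ≤ T ∧
      a₁ / ((T : ℝ) ^ ((1 - ρ) / 4)) ^ 3 ≤ α T ∧ α T ≤ a₂ / ((T : ℝ) ^ ((1 - ρ) / 4)) ^ 3 ∧
      b₁ / (T : ℝ) ^ ((1 - ρ) / 4) ≤ δ T ∧ δ T ≤ b₂ / (T : ℝ) ^ ((1 - ρ) / 4) ∧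
      variation xs T ≤ T / ((T : ℝ) ^ ((1 - ρ) / 4)) ^ 4 := by
    filter_upwards [hα, hδ, eventually_variation_le hV, eventually_ge_atTop 1] with T h1 h2 h3 h4
    obtain ⟨e1, e2, e3, e4, -, e6⟩ := rpow_horizon_one (T := T) (by exact_mod_cast h4) hρ
    rw [e3, mul_one_div, mul_one_div] at h1
    rw [e4, mul_one_div, mul_one_div] at h2
    rw [e6] at h3
    exact ⟨e1, e2, h1.1, h1.2, h2.1, h2.2, h3⟩
  have hδpos : ∀ᶠ T in atTop, 0 < δ T := by
    filter_upwards [hbounds] with T hT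
    exact lt_of_lt_of_le (div_pos hb₁ (by linarith [hT.1])) hT.2.2.2.2.1
  have hδlim : ∀ c > 0, ∀ᶠ T in atTop, δ T ≤ c := fun c hc => by
    filter_upwards [hbounds, eventually_div_rpow_le hε b₂ hc] with T hT hT'
    exact hT.2.2.2.2.2.1.trans hT'
  obtain ⟨z, hzg, hz⟩ := h.exists_slater_mem hδpos hδlim
  refine ⟨z, ?_⟩
  have ha₂ : 0 < a₂ := by
    obtain ⟨T, hT1, -, hT3, hT4, -⟩ := hbounds.exists
    have hs : 0 < ((T : ℝ) ^ ((1 - ρ) / 4)) ^ 3 := by positivity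
    have := (div_pos ha₁ hs).trans_le (hT3.trans hT4)
    rwa [div_pos_iff_of_pos_right hs] at this
  -- The quotient `w / δ T` will serve as `Ξ`; the added `1` keeps `w` positive when `F = 0` and
  -- gives `δ T ≤ w`.
  set w : ℝ := 2 * R * (d * F) + 1 with hw
  have hw1 : 1 ≤ w := by rw [hw]; linarith [show 0 ≤ 2 * R * (d * F) by positivity]
  set κ : ℝ := a₂ * (((d * F / b₁) ^ 2 + N * (4 * R * G + η) ^ 2) / 2) with hκ
  have hc0 : 0 < b₁ ^ 2 / (a₂ * w ^ 2) := by positivity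
  filter_upwards [hbounds, hδpos, hz, hx, hδlim 1 one_pos, eventually_sq_mul_exp_le hε hc0,
    eventually_div_rpow_le hε κ (one_half_pos (α := ℝ)),
    eventually_div_rpow_le hε a₂ (one_pos (α := ℝ)),
    eventually_div_rpow_le hε (a₂ * w / b₁) (one_half_pos (α := ℝ))]
    with T hT hδ0 hzT hxT hδ1 hexp hκT ha₂T hwT
  obtain ⟨hs1, hsT, hα1, hα2, hδ2, hδ3, hVT⟩ := hT
  set s := (T : ℝ) ^ ((1 - ρ) / 4) with hs
  have hs0 : 0 < s := by linarith
  have hα0 : 0 < α T := lt_of_lt_of_le (by positivity) hα1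
  have H : Q.RunBounds Feedback.one η r (α T) (δ T) (d * F / δ T) (x₁ T) z :=
    ⟨hα0, hδ0, hzT.1, fun t x hx v => h.norm_gradEst_one_le hδ0 hzT.1 t hx v, hxT, hzT.2, hzg⟩
  have hr := rates_one (d := d) (N := N) (G := G) (η := η) (R := R) ha₁ hb₁ hF hs1 hsT hα1 hα2
    hδ2 hδ3 hVT
  refine ⟨H, hr, ?_⟩
  have hK := stepConst_nonneg N G η R (d * F / δ T)
  have hαK : α T * stepConst N G η R (d * F / δ T) ≤ 1 / 2 := hr.K_le.trans hκT
  have hα1' : α T ≤ 1 := hr.a_le.trans ha₂T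
  have hαw : α T * (w / δ T) ≤ 1 / 2 := by
    refine le_trans ?_ hwT
    calc α T * (w / δ T) ≤ a₂ / s ^ 3 * (w / (b₁ / s)) := by gcongr
      _ = a₂ * w / b₁ / s ^ 2 := by field_simp
      _ ≤ a₂ * w / b₁ / s := by
        gcongr
        exact le_self_pow₀ hs1 (by norm_num)
  -- Chosen so that the second-order term `θ * α T * (w / δ T) ^ 2` equals `1`. As `δ ^ 2` is of
  -- order `s ^ (-2)` and `α` of order `s ^ (-3)`, this `θ` grows at least like `s`, a positive
  -- power of the horizon.
  set θ : ℝ := δ T ^ 2 / (α T * w ^ 2) with hθ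
  have hθ0 : 0 ≤ θ := by positivity
  have hθs : b₁ ^ 2 / (a₂ * w ^ 2) * s ≤ θ := by
    calc b₁ ^ 2 / (a₂ * w ^ 2) * s = (b₁ / s) ^ 2 / (a₂ / s ^ 3 * w ^ 2) := by field_simp
      _ ≤ θ := by rw [hθ]; gcongr
  have e1 : θ * α T * (w / δ T) ≤ 1 := by
    have : θ * α T * (w / δ T) = δ T / w := by rw [hθ]; field_simp
    rw [this, div_le_one (by linarith)]
    linarith
  have e2 : θ * α T * (w / δ T) ^ 2 = 1 := by rw [hθ]; field_simp
  have e3 : 2 * R * (d * F / δ T) ≤ w / δ T := by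
    rw [← mul_div_assoc]
    gcongr
    linarith
  -- The level covers the mean `2 * F + 2 * δ * G`, the second-order term `1` and `α * stepConst ≤ 1
  -- / 2`.
  have hL : η * ((2 * F + 2 * G + 2) / η) = 2 * F + 2 * G + 2 := by field_simp
  have e4 : δ T * G ≤ G := mul_le_of_le_one_left hG hδ1
  have e5 : α T ^ 2 * stepConst N G η R (d * F / δ T) ≤ 1 / 2 := by
    calc _ = α T * (α T * stepConst N G η R (d * F / δ T)) := by ring
      _ ≤ 1 * (1 / 2) := by gcongr
      _ = _ := one_mul _
  have key := H.measureReal_exists_potential_ge_le hd h hθ0 e3 e1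
    (L := (2 * F + 2 * G + 2) / η) (by rw [e2, hL]; linarith) (by linarith) T
  refine key.trans (le_trans ?_ hexp)
  gcongr

/-- Two-point feedback: for all large horizons the parameters have the required rates and the
potential is bounded. -/
theorem Regular.eventually_two (hd : 0 < d) (h : Q.Regular F G η r R) {ρ a₁ a₂ b₂ : ℝ}
    (hρ : ρ ∈ Set.Ico (0 : ℝ) 1) (ha₁ : 0 < a₁) {xs : ℕ → Vec d}
    (hV : (fun T : ℕ => variation xs T) =o[atTop] (fun T : ℕ => (T : ℝ) ^ ρ))
    {α δ : ℕ → ℝ} {x₁ : ℕ → Vec d}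
    (hα : ∀ᶠ T : ℕ in atTop, a₁ * (T : ℝ) ^ ((ρ - 1) / 2) ≤ α T ∧
      α T ≤ a₂ * (T : ℝ) ^ ((ρ - 1) / 2))
    (hδ : ∀ᶠ T : ℕ in atTop, 0 < δ T ∧ δ T ≤ b₂ * (T : ℝ) ^ ((ρ - 1) / 2))
    (hx : ∀ᶠ T : ℕ in atTop, x₁ T ∈ (1 - δ T / r) • Q.X) :
    ∃ z, ∀ᶠ T : ℕ in atTop,
      Q.RunBounds Feedback.two η r (α T) (δ T) (d * G) (x₁ T) z ∧
      Rates T ((T : ℝ) ^ ((1 - ρ) / 2)) (α T) (δ T) (d * G)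
        (stepConst N G η R (d * G)) (variation xs T) (1 / a₁) b₂
        (a₂ * stepConst N G η R (d * G)) (a₂ * (d * G)) a₂ ∧
      ∀ v, ∀ t ≤ T, potential z
        (Q.iterate Feedback.two (coupledParams r (α T) (δ T)) (x₁ T) v t) ≤
        ((2 * R * (d * G) + 1) / η) ^ 2 / 2 + 2 * R ^ 2 + 1 := by
  have hε : 0 < (1 - ρ) / 2 := by linarith [hρ.2]
  have hG := h.G_nonneg
  have hR := h.R_pos
  have hη := h.eta_pos
  have hbounds : ∀ᶠ T : ℕ in atTop, 1 ≤ (T : ℝ) ^ ((1 - ρ) / 2) ∧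
      ((T : ℝ) ^ ((1 - ρ) / 2)) ^ 2 ≤ T ∧
      a₁ / (T : ℝ) ^ ((1 - ρ) / 2) ≤ α T ∧ α T ≤ a₂ / (T : ℝ) ^ ((1 - ρ) / 2) ∧
      0 < δ T ∧ δ T ≤ b₂ / (T : ℝ) ^ ((1 - ρ) / 2) ∧
      variation xs T ≤ T / ((T : ℝ) ^ ((1 - ρ) / 2)) ^ 2 := by
    filter_upwards [hα, hδ, eventually_variation_le hV, eventually_ge_atTop 1] with T h1 h2 h3 h4
    obtain ⟨e1, e2, e3, -, e6⟩ := rpow_horizon_two (T := T) (by exact_mod_cast h4) hρ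
    rw [e3, mul_one_div, mul_one_div] at h1
    rw [e3, mul_one_div] at h2
    rw [e6] at h3
    exact ⟨e1, e2, h1.1, h1.2, h2.1, h2.2, h3⟩
  have hδlim : ∀ c > 0, ∀ᶠ T in atTop, δ T ≤ c := fun c hc => by
    filter_upwards [hbounds, eventually_div_rpow_le hε b₂ hc] with T hT hT'
    exact hT.2.2.2.2.2.1.trans hT'
  obtain ⟨z, hzg, hz⟩ := h.exists_slater_mem (hδ.mono fun T hT => hT.1) hδlim
  refine ⟨z, ?_⟩
  set K := stepConst N G η R (d * G)
  filter_upwards [hbounds, hz, hx, eventually_div_rpow_le hε (a₂ * K) (one_half_pos (α := ℝ)),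
    eventually_div_rpow_le hε a₂ (one_pos (α := ℝ)),
    eventually_div_rpow_le hε (a₂ * (2 * R * (d * G))) (one_half_pos (α := ℝ))]
    with T hT hzT hxT hKT ha₂T hBT
  obtain ⟨hq1, hqT, hα1, hα2, hδ0, hδ3, hVT⟩ := hT
  set q := (T : ℝ) ^ ((1 - ρ) / 2) with hq
  have hq0 : 0 < q := by linarith
  have hα0 : 0 < α T := lt_of_lt_of_le (by positivity) hα1
  have H : Q.RunBounds Feedback.two η r (α T) (δ T) (d * G) (x₁ T) z :=
    ⟨hα0, hδ0, hzT.1, fun t x hx v => h.norm_gradEst_two_le hδ0 hzT.1 t hx v, hxT, hzT.2, hzg⟩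
  have hr := rates_two (d := d) (N := N) (η := η) (R := R) ha₁ hG hq1 hqT hα1 hα2 hδ3 hVT
  refine ⟨H, hr, fun v t _ => ?_⟩
  have hαK : α T * K ≤ 1 / 2 := hr.K_le.trans hKT
  have hα1' : α T ≤ 1 := hr.a_le.trans ha₂T
  have hK : 0 ≤ K := stepConst_nonneg _ _ _ _ _
  refine H.potential_iterate_le_const hd h ?_ ?_ v t
  -- The `1` in the level leaves room for `α T * K ≤ 1 / 2`.
  · have : η * ((2 * R * (d * G) + 1) / η) = 2 * R * (d * G) + 1 := by field_simp
    rw [this]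
    change 2 * R * (d * G) + α T * K ≤ _
    linarith
  · have e1 : α T * (2 * R * (d * G)) ≤ 1 / 2 := by
      refine le_trans ?_ hBT
      calc α T * (2 * R * (d * G)) ≤ a₂ / q * (2 * R * (d * G)) := by gcongr
        _ = _ := by ring
    have e2 : α T ^ 2 * K ≤ 1 / 2 := by
      calc _ = α T * (α T * K) := by ring
        _ ≤ 1 * (1 / 2) := by gcongr
        _ = _ := one_mul _
    change _ + α T ^ 2 * K ≤ 1
    linarith

end OnlineProblem

/-! ### The two rates -/

theorem corollary1 (d N : ℕ) (hd : 0 < d) (F G η r R ρ : ℝ) (hρ : ρ ∈ Set.Ico (0 : ℝ) 1)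
    (a₁ a₂ b₁ b₂ : ℝ) (ha₁ : 0 < a₁) (hb₁ : 0 < b₁) :
    -- one-point feedback
    (∃ C : ℝ, ∀ (Q : OnlineProblem d N), Q.Regular F G η r R →
      ∀ (xs : ℕ → Vec d), Q.IsSlotMinimizer xs →
      (fun T : ℕ => variation xs T) =o[atTop] (fun T : ℕ => (T : ℝ) ^ ρ) →
      ∀ (α δ : ℕ → ℝ) (x₁ : ℕ → Vec d),
      (∀ᶠ T : ℕ in atTop, a₁ * (T : ℝ) ^ (3 * (ρ - 1) / 4) ≤ α T ∧
        α T ≤ a₂ * (T : ℝ) ^ (3 * (ρ - 1) / 4)) →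
      (∀ᶠ T : ℕ in atTop, b₁ * (T : ℝ) ^ ((ρ - 1) / 4) ≤ δ T ∧
        δ T ≤ b₂ * (T : ℝ) ^ ((ρ - 1) / 4)) →
      (∀ᶠ T : ℕ in atTop, x₁ T ∈ (1 - δ T / r) • Q.X) →
      ∀ (Ω : Type*) [MeasurableSpace Ω] (P : Measure Ω) [IsProbabilityMeasure P]
        (u : ℕ → ℕ → Ω → UnitSphere d), (∀ T, IsUniformIID P (u T)) →
      -- dynamic regret
      (∀ᶠ T : ℕ in atTop,
        (∀ t < T, ∀ m, Integrable (fun ω => Q.f t (Q.action Feedback.one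
          (coupledParams r (α T) (δ T)) (x₁ T) (fun s => u T s ω) t m)) P) ∧
        Q.regret Feedback.one (coupledParams r (α T) (δ T)) (x₁ T) P (u T) xs T
          ≤ C * (T : ℝ) ^ ((ρ + 3) / 4)) ∧
      -- dynamic fit, almost surely and in expectation
      (∀ᵐ ω ∂P, ∀ᶠ T : ℕ in atTop,
        Q.fit Feedback.one (coupledParams r (α T) (δ T)) (x₁ T) (fun s => u T s ω) T
          ≤ C * (T : ℝ) ^ ((ρ + 3) / 4)) ∧
      (∀ᶠ T : ℕ in atTop,
        Integrable (fun ω => Q.fit Feedback.one (coupledParams r (α T) (δ T)) (x₁ T)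
          (fun s => u T s ω) T) P ∧
        ∫ ω, Q.fit Feedback.one (coupledParams r (α T) (δ T)) (x₁ T) (fun s => u T s ω) T ∂P
          ≤ C * (T : ℝ) ^ ((ρ + 3) / 4))) ∧
    -- two-point feedback
    (∃ C : ℝ, ∀ (Q : OnlineProblem d N), Q.Regular F G η r R →
      ∀ (xs : ℕ → Vec d), Q.IsSlotMinimizer xs →
      (fun T : ℕ => variation xs T) =o[atTop] (fun T : ℕ => (T : ℝ) ^ ρ) →
      ∀ (α δ : ℕ → ℝ) (x₁ : ℕ → Vec d),
      (∀ᶠ T : ℕ in atTop, a₁ * (T : ℝ) ^ ((ρ - 1) / 2) ≤ α T ∧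
        α T ≤ a₂ * (T : ℝ) ^ ((ρ - 1) / 2)) →
      (∀ᶠ T : ℕ in atTop, 0 < δ T ∧ δ T ≤ b₂ * (T : ℝ) ^ ((ρ - 1) / 2)) →
      (∀ᶠ T : ℕ in atTop, x₁ T ∈ (1 - δ T / r) • Q.X) →
      ∀ (Ω : Type*) [MeasurableSpace Ω] (P : Measure Ω) [IsProbabilityMeasure P]
        (u : ℕ → ℕ → Ω → UnitSphere d), (∀ T, IsUniformIID P (u T)) →
      -- dynamic regret
      (∀ᶠ T : ℕ in atTop,
        (∀ t < T, ∀ m, Integrable (fun ω => Q.f t (Q.action Feedback.two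
          (coupledParams r (α T) (δ T)) (x₁ T) (fun s => u T s ω) t m)) P) ∧
        Q.regret Feedback.two (coupledParams r (α T) (δ T)) (x₁ T) P (u T) xs T
          ≤ C * (T : ℝ) ^ ((ρ + 1) / 2)) ∧
      -- dynamic fit, almost surely with a non-random threshold on the horizon
      (∀ᶠ T : ℕ in atTop, ∀ᵐ ω ∂P,
        Q.fit Feedback.two (coupledParams r (α T) (δ T)) (x₁ T) (fun s => u T s ω) T
          ≤ C * (T : ℝ) ^ ((ρ + 1) / 2))) := by
  -- In the one-point constant the `+ 1` pays for the exceptional event in the expected fit: there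
  -- the crude bound times `1 / T ^ 2` is eventually at most `1`, hence at most the rate.
  refine ⟨⟨max (regretConst F G η r R (1 / a₁) b₂
      (a₂ * (((d * F / b₁) ^ 2 + N * (4 * R * G + η) ^ 2) / 2)))
      (fitConst N G (N * (2 * OnlineProblem.highProbBound F G η R + 1)) (1 / a₁) b₂
        (a₂ * (d * F / b₁)) a₂ + 1), ?_⟩,
    ⟨max (regretConst F G η r R (1 / a₁) b₂ (a₂ * OnlineProblem.stepConst N G η R (d * G)))
      (fitConst N G (N * (2 * (((2 * R * (d * G) + 1) / η) ^ 2 / 2 + 2 * R ^ 2 + 1) + 1))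
        (1 / a₁) b₂ (a₂ * (d * G)) a₂), ?_⟩⟩
  · intro Q h xs hxs hV α δ x₁ hα hδ hx Ω _ P _ u hu
    obtain ⟨z, hz⟩ := h.eventually_one hd hρ ha₁ hb₁ hV hα hδ hx
    have hrate : ∀ᶠ T : ℕ in atTop, 1 ≤ (T : ℝ) / (T : ℝ) ^ ((1 - ρ) / 4) ∧
        (T : ℝ) ^ ((ρ + 3) / 4) = T / (T : ℝ) ^ ((1 - ρ) / 4) := by
      filter_upwards [hz, eventually_ge_atTop 1] with T hT hT1
      obtain ⟨e1, -, -, -, e5, -⟩ := rpow_horizon_one (T := T) (by exact_mod_cast hT1) hρ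
      exact ⟨(one_le_div (by linarith)).2 hT.2.1.le_T, e5⟩
    refine ⟨?_, ?_, ?_⟩
    · filter_upwards [hz, hrate] with T ⟨H, hr, _⟩ ⟨hT1, hT2⟩
      refine ⟨fun t _ m => H.integrable_f_action_comp hd h (hu T) t m, ?_⟩
      rw [hT2]
      refine (H.regret_le_rate hd h (hu T) hxs T hr).trans ?_
      gcongr
      exact le_max_left _ _
    · obtain ⟨T₀, hT₀⟩ := eventually_atTop.1 (hz.and hrate)
      -- Borel–Cantelli applies to these sets whatever the dependence between horizons. The
      -- condition `T₀ ≤ T` empties them where no probability bound is available.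
      set A : ℕ → Set Ω := fun T => {ω | T₀ ≤ T ∧ ∃ t ≤ T,
        OnlineProblem.highProbBound F G η R ≤ OnlineProblem.potential z
          (Q.iterate Feedback.one (coupledParams r (α T) (δ T)) (x₁ T) (fun s => u T s ω) t)}
        with hA
      have hPA (T : ℕ) : P (A T) ≤ ENNReal.ofReal (1 / (T : ℝ) ^ 2) := by
        have := isProbabilityMeasure_sphereSeq hd
        by_cases hT : T₀ ≤ T
        · have hlaw := (hu T).hasLaw
          have h1 := Measure.le_map_apply hlaw.aemeasurable {v | ∃ t ≤ T,
            OnlineProblem.highProbBound F G η R ≤ OnlineProblem.potential z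
            (Q.iterate Feedback.one (coupledParams r (α T) (δ T)) (x₁ T) v t)}
          rw [hlaw.map_eq] at h1
          refine (measure_mono fun ω hω => hω.2).trans (h1.trans ?_)
          rw [← ofReal_measureReal]
          exact ENNReal.ofReal_le_ofReal (hT₀ T hT).1.2.2
        · have : A T = ∅ := by
            ext ω
            simp [hA, hT]
          rw [this, measure_empty]
          exact zero_le
      have hsum : ∑' T, P (A T) ≠ ⊤ := ne_top_of_le_ne_top
        (Real.summable_one_div_nat_pow.2 one_lt_two).tsum_ofReal_ne_top (ENNReal.tsum_le_tsum hPA)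
      filter_upwards [ae_eventually_notMem hsum] with ω hω
      filter_upwards [hω, eventually_ge_atTop T₀] with T hT hTT₀
      obtain ⟨⟨H, hr, -⟩, hT1, hT2⟩ := hT₀ T hTT₀
      rw [hT2]
      refine (H.fit_le_rate h T (C := OnlineProblem.highProbBound F G η R) (H.B_nonneg hd) hr _
        fun t ht => ?_).trans ?_
      · by_contra! hlt
        exact hT ⟨hTT₀, t, ht, hlt.le⟩
      · gcongr
        exact (le_add_of_nonneg_right zero_le_one).trans (le_max_right _ _)
    · filter_upwards [hz, hrate, eventually_div_rpow_le one_pos (N * (2 * R * G)) one_pos,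
        eventually_ge_atTop 1] with T ⟨H, hr, hp⟩ ⟨hT1, hT2⟩ hTN hT3
      refine ⟨(hu T).hasLaw.integrable_comp (H.integrable_fit hd h T), ?_⟩
      have e := (hu T).hasLaw.integral_comp (H.integrable_fit hd h T).aestronglyMeasurable
      simp only [Function.comp_def] at e
      rw [e, hT2]
      refine (H.integral_fit_le hd h T hr (OnlineProblem.highProbBound_nonneg _ _ _ _) hp).trans ?_
      have hT0 : (0 : ℝ) < T := by exact_mod_cast hT3
      have e1 : (N : ℝ) * (T * (2 * R * G)) * (1 / (T : ℝ) ^ 2) ≤ 1 := by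
        rw [Real.rpow_one] at hTN
        calc _ = N * (2 * R * G) / (T : ℝ) := by field_simp
          _ ≤ 1 := hTN
      calc _ ≤ (fitConst N G (N * (2 * OnlineProblem.highProbBound F G η R + 1)) (1 / a₁) b₂
            (a₂ * (d * F / b₁)) a₂ + 1) * ((T : ℝ) / (T : ℝ) ^ ((1 - ρ) / 4)) := by linarith
        _ ≤ _ := by
          gcongr
          exact le_max_right _ _
  · intro Q h xs hxs hV α δ x₁ hα hδ hx Ω _ P _ u hu
    obtain ⟨z, hz⟩ := h.eventually_two hd hρ ha₁ hV hα hδ hx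
    have hrate : ∀ᶠ T : ℕ in atTop,
        (T : ℝ) ^ ((ρ + 1) / 2) = T / (T : ℝ) ^ ((1 - ρ) / 2) := by
      filter_upwards [eventually_ge_atTop 1] with T hT1
      exact (rpow_horizon_two (T := T) (by exact_mod_cast hT1) hρ).2.2.2.1
    refine ⟨?_, ?_⟩
    · filter_upwards [hz, hrate] with T ⟨H, hr, _⟩ hT2
      refine ⟨fun t _ m => H.integrable_f_action_comp hd h (hu T) t m, ?_⟩
      rw [hT2]
      refine (H.regret_le_rate hd h (hu T) hxs T hr).trans ?_
      gcongr
      exact le_max_left _ _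
    · filter_upwards [hz, hrate] with T ⟨H, hr, hpot⟩ hT2
      -- The potential bound holds for every sequence of directions, so no null set has to be
      -- removed.
      refine ae_of_all _ fun ω => ?_
      rw [hT2]
      refine (H.fit_le_rate h T (H.B_nonneg hd) hr _ (hpot _)).trans ?_
      gcongr
      exact le_max_right _ _
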